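/- \textbf{Theorem (exactly four singularities).} Let $B$ be a Blaschke product on the unit disc $\mathbb{D}$, i.e. $B(z)=\lambda z^p\prod_j \frac{|a_j|}{a_j}\frac{a_j-z}{1-\overline{a_j}z}$ with $|\lambda|=1$, $p\ge 0$, $0<|a_j|<1$ and $\sum_j(1-|a_j|)<\infty$. Its singularities are the points of the unit circle $\mathbb{T}$ to no neighbourhood of which $B$ has an analytic extension; at the other (regular) points $B$ denotes the extension. Suppose that $B$ has exactly four singularities. Let $\mathcal{G}$ be the set, under composition, of all continuous maps $x:\mathbb{T}\to\mathbb{T}$ that map singular points to singular points and regular points to regular points and satisfy $B(x(\xi))=B(\xi)$ at every regular $\xi$. Then $\mathcal{G}$ is a group, isomorphic to one of $\{e\}$, $\mathbb{Z}_2$, $\mathbb{Z}_4$, $\mathbb{Z}^k$ ($k=1,2,3$), $\mathbb{Z}^2\rtimes\mathbb{Z}_2$, $\mathbb{Z}^4\rtimes\mathbb{Z}_4$, where $\mathbb{Z}_n$ acts on $\mathbb{Z}^n$ by cyclically shifting the coordinates. Which one occurs is determined by the types of the four arcs $I_1,\dots,I_4$ (in cyclic order) of the complement of the singularities, as follows.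 An arc is of type $0$ if it contains only finitely many solutions of $B=1$; if it contains infinitely many, it is of type $1_a$, $1_b$ or $2$ according as they accumulate precisely at its initial end point, precisely at its final end point, or precisely at both end points (the circle being oriented counterclockwise). Two arcs are of exactly the same type if both are of type $0$ and have the same image under $B$, counting multiplicities; or both are of type $1_a$ (respectively $1_b$) and $B$ has the same one-sided limit along them at their final (respectively initial) end points; or both are of type $2$. Let $k$ be the number of arcs of type $2$, and $d$ the number of $r\in\mathbb{Z}_4$ such that, for every $j$, the arcs $I_j$ and $I_{j+r}$ (indices modulo $4$) are of exactly the same type. Then one of the following holds: - $d=1$, $k\in\{0,1,2,3\}$ and $\mathcal{G}\cong\mathbb{Z}^k$ (trivial for $k=0$); - $d=2$, $k=0$ and $\mathcal{G}\cong\mathbb{Z}_2$, or $d=2$, $k=2$ and $\mathcal{G}\cong\mathbb{Z}^2\rtimes\mathbb{Z}_2$; - $d=4$, $k=0$ and $\mathcal{G}\cong\mathbb{Z}_4$, or $d=4$, $k=4$ and $\mathcal{G}\cong\mathbb{Z}^4\rtimes\mathbb{Z}_4$. -/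

import Mathlib

open Set Filter Topology

noncomputable section

/-- `B` is, on the open unit disc, a (finite or infinite) Blaschke product
`B(z) = c z ^ p ∏ⱼ (|aⱼ| / aⱼ) (aⱼ - z) / (1 - conj aⱼ z)`. Its values off the disc are
irrelevant. The zeros `aⱼ ≠ 0` are indexed, with repetitions allowed, by a set `S` of natural
numbers. -/
def IsBlaschkeProduct (B : ℂ → ℂ) : Prop :=
  ∃ (c : ℂ) (p : ℕ) (S : Set ℕ) (a : S → ℂ),
    ‖c‖ = 1 ∧ (∀ j, 0 < ‖a j‖ ∧ ‖a j‖ < 1) ∧ Summable (fun j => 1 - ‖a j‖) ∧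
    ∀ z ∈ Metric.ball (0 : ℂ) 1,
      B z = c * z ^ p *
        ∏' j, ((‖a j‖ : ℂ) / a j * ((a j - z) / (1 - (starRingEnd ℂ) (a j) * z)))

/-- The singularities of `B` on the unit circle: the points `ξ` such that `B`, restricted to the
open disc, has no analytic extension to a neighbourhood of `ξ`. -/
def singularSet (B : ℂ → ℂ) : Set Circle :=
  {ξ | ¬ ∃ g : ℂ → ℂ, AnalyticAt ℂ g (ξ : ℂ) ∧ g =ᶠ[𝓝[Metric.ball (0 : ℂ) 1] (ξ : ℂ)] B}

/-- The value of `B` at a point `ξ` of the circle, that is, the limit of `B(z)` as `z → ξ` inside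
the disc. It is only used at regular points, where this limit exists and is the value of the
analytic extension. -/
def boundaryValue (B : ℂ → ℂ) (ξ : Circle) : ℂ :=
  extendFrom (Metric.ball (0 : ℂ) 1) B (ξ : ℂ)

/-- The continuous invariants of `B` under composition: the continuous maps `x : 𝕋 → 𝕋` that map
singular points to singular points and regular points to regular points, and satisfy
`B ∘ x = B` at the regular points. -/
def invariants (B : ℂ → ℂ) : Submonoid (Function.End Circle) where
  carrier := {x | Continuous (x : Circle → Circle) ∧
    (∀ ξ : Circle, x ξ ∈ singularSet B ↔ ξ ∈ singularSet B) ∧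
    ∀ ξ : Circle, ξ ∉ singularSet B → boundaryValue B (x ξ) = boundaryValue B ξ}
  one_mem' := ⟨continuous_id, fun _ => Iff.rfl, fun _ _ => rfl⟩
  mul_mem' := by
    rintro x y ⟨hx, hx', hx''⟩ ⟨hy, hy', hy''⟩
    refine ⟨hx.comp hy, fun ξ => (hx' (y ξ)).trans (hy' ξ), fun ξ hξ => ?_⟩
    exact (hx'' (y ξ) (fun h => hξ ((hy' ξ).1 h))).trans (hy'' ξ hξ)

/-- The angles `t` in `(α, β)` with `B(e^{it}) = w`. -/
def arcSolutions (B : ℂ → ℂ) (α β : ℝ) (w : ℂ) : Set ℝ :=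
  {t ∈ Ioo α β | boundaryValue B (Circle.exp t) = w}

/-- The arc `(e^{iα}, e^{iβ})` is of type `0`: it contains only finitely many solutions of
`B = 1`. -/
def IsType0 (B : ℂ → ℂ) (α β : ℝ) : Prop :=
  (arcSolutions B α β 1).Finite

/-- The arc `(e^{iα}, e^{iβ})` is of type `1_a`: it contains infinitely many solutions of `B = 1`,
accumulating precisely at its initial point. -/
def IsType1a (B : ℂ → ℂ) (α β : ℝ) : Prop :=
  (arcSolutions B α β 1).Infinite ∧ derivedSet (arcSolutions B α β 1) = {α}

/-- The arc `(e^{iα}, e^{iβ})` is of type `1_b`: it contains infinitely many solutions of `B = 1`,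
accumulating precisely at its final point. -/
def IsType1b (B : ℂ → ℂ) (α β : ℝ) : Prop :=
  (arcSolutions B α β 1).Infinite ∧ derivedSet (arcSolutions B α β 1) = {β}

/-- The arc `(e^{iα}, e^{iβ})` is of type `2`: it contains infinitely many solutions of `B = 1`,
accumulating precisely at its two end points. -/
def IsType2 (B : ℂ → ℂ) (α β : ℝ) : Prop :=
  (arcSolutions B α β 1).Infinite ∧ derivedSet (arcSolutions B α β 1) = {α, β}

/-- The arcs `(e^{iα}, e^{iβ})` and `(e^{iα'}, e^{iβ'})` are of exactly the same type: both of
type `0` with the same image under `B`, counting multiplicities; or both of type `1_a` (resp.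
`1_b`) with the same one-sided limit of `B` at the final (resp. initial) point; or both of
type `2`. -/
def SameArcType (B : ℂ → ℂ) (α β α' β' : ℝ) : Prop :=
  (IsType0 B α β ∧ IsType0 B α' β' ∧
    ∀ w : ℂ, (arcSolutions B α β w).encard = (arcSolutions B α' β' w).encard) ∨
  (IsType1a B α β ∧ IsType1a B α' β' ∧
    ∃ L : ℂ, Tendsto (fun t => boundaryValue B (Circle.exp t)) (𝓝[<] β) (𝓝 L) ∧
      Tendsto (fun t => boundaryValue B (Circle.exp t)) (𝓝[<] β') (𝓝 L)) ∨
  (IsType1b B α β ∧ IsType1b B α' β' ∧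
    ∃ L : ℂ, Tendsto (fun t => boundaryValue B (Circle.exp t)) (𝓝[>] α) (𝓝 L) ∧
      Tendsto (fun t => boundaryValue B (Circle.exp t)) (𝓝[>] α') (𝓝 L)) ∨
  (IsType2 B α β ∧ IsType2 B α' β')

/-- The increasing sequence `θ` lists, going around the circle counterclockwise and with period
`n`, the arguments of the `n` singularities of `B`. The arcs making up the complement of the
singular set are then `(e^{iθ j}, e^{iθ (j + 1)})`, `j` modulo `n`. -/
def IsCyclicListing (B : ℂ → ℂ) (n : ℕ) (θ : ℤ → ℝ) : Prop :=
  StrictMono θ ∧ (∀ j, θ (j + n) = θ j + 2 * Real.pi) ∧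
    singularSet B = range (fun j => Circle.exp (θ j))

/-- The number of arcs of type `2` among the `n` arcs. -/
def numType2 (B : ℂ → ℂ) (n : ℕ) (θ : ℤ → ℝ) : ℕ :=
  {j : ℤ | 0 ≤ j ∧ j < n ∧ IsType2 B (θ j) (θ (j + 1))}.ncard

/-- The number of cyclic permutations `j ↦ j + r` (`r` modulo `n`) of the `n` arcs that map each
arc onto one of exactly the same type. -/
def numRotations (B : ℂ → ℂ) (n : ℕ) (θ : ℤ → ℝ) : ℕ :=
  {r : ℤ | 0 ≤ r ∧ r < n ∧
    ∀ j : ℤ, SameArcType B (θ j) (θ (j + 1)) (θ (j + r)) (θ (j + r + 1))}.ncard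

/-- The group `ℤ ^ k`, written multiplicatively. -/
abbrev FreeAb (k : ℕ) : Type := Fin k → Multiplicative ℤ

/-- The action of `ℤ_n` on `ℤ ^ n` (indexed by `ℤ_n`) by cyclic shifts of the coordinates: the
residue `r` moves coordinate `j` to coordinate `j + r`. -/
def cyclicShift (n : ℕ) : Multiplicative (ZMod n) →* MulAut (ZMod n → Multiplicative ℤ) where
  toFun r :=
    { toFun := fun f j => f (j - r.toAdd)
      invFun := fun f j => f (j + r.toAdd)
      left_inv := fun f => by funext j; simp
      right_inv := fun f => by funext j; simp
      map_mul' := fun _ _ => rfl }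
  map_one' := by ext f j; simp
  map_mul' r s := by
    ext f j
    simp [sub_sub]

/-- The semidirect product `ℤ ^ n ⋊ ℤ_n` for the cyclic shift action. -/
abbrev ShiftProduct (n : ℕ) : Type :=
  SemidirectProduct (ZMod n → Multiplicative ℤ) (Multiplicative (ZMod n)) (cyclicShift n)

end

/-! On a regular arc the zeros stay away from the circle, the product converges and is unimodular
there, and `ξ B'(ξ) / B(ξ)` equals `p` plus a sum of Poisson kernels `(1 - |a_j|²) / |a_j - ξ|²`,
hence is positive. So on the `j`-th arc `B(e^{it}) = e^{iφ_j(t)}` with `φ_j` continuous and strictly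
increasing (`exists_continuous_argument`), and everything about `B` on the arc is encoded in the
open interval `E_j = φ_j(I_j)`. Solutions of `B = 1` are points where `φ_j` meets `2πℤ`, so the type
of the arc says which ends of `E_j` are infinite, and type `2` means `E_j = ℝ`. Two arcs are of
exactly the same type if and only if their intervals differ by a translation in `2πℤ`
(`IsArgumentOn.sameArcType_iff`). The arguments can be normalised so that such intervals are equal
(`ArcSystem`).

An invariant `x` lifts to a continuous `X : ℝ → ℝ` that preserves the set of singular angles. It
carries each arc into one arc, where `φ ∘ X - φ_j` is a continuous function with values in `2πℤ`,
hence a constant `2πn_j`. Thus `X` is increasing on arcs, matches endpoints, and moves every arc by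
the same number `r` of places. Then `E_{j+r} = E_j + 2πn_j`, so by the normalisation `E_{j+r} =
E_j`, and `n_j = 0` unless `E_j = ℝ`. Conversely, all such data `(n, r)` define an invariant.
Composition of maps is the semidirect product law, so the invariants form the subgroup `colorGroup`
of `ℤ^4 ⋊ ℤ_4`: rotations preserving the colouring `j ↦ E_j`, with translations supported on the
colour `ℝ` (`ArcSystem.nonempty_mulEquiv`).

What remains is finite. The rotations preserving a colouring form `{0}`, `{0, 2}` or `ℤ_4`, and the
points of a given colour are a union of orbits (`colorGroup.classification`). -/

/-! ### Estimates for a single Blaschke factor -/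

/-- The factor `(|a| / a) (a - z) / (1 - conj a z)` of a Blaschke product. -/
noncomputable def blaschkeFactor (a z : ℂ) : ℂ :=
  (‖a‖ : ℂ) / a * ((a - z) / (1 - (starRingEnd ℂ) a * z))

/-- The Blaschke product `c z ^ p ∏ⱼ (|aⱼ| / aⱼ) (aⱼ - z) / (1 - conj aⱼ z)` as a function on the
whole plane. -/
noncomputable def blaschkeProd {ι : Type*} (c : ℂ) (p : ℕ) (a : ι → ℂ) (z : ℂ) : ℂ :=
  c * z ^ p * ∏' j, blaschkeFactor (a j) z

/-- The factor `1 - |a|` splits off because `a · conj a = |a|²`; it is what makes the Blaschke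
condition imply convergence of the product. -/
theorem blaschkeFactor_sub_one {a z : ℂ} (ha : a ≠ 0) (hz : 1 - (starRingEnd ℂ) a * z ≠ 0) :
    blaschkeFactor a z - 1 =
      -((1 - ‖a‖) * (a + ‖a‖ * z) / (a * (1 - (starRingEnd ℂ) a * z))) := by
  have h := Complex.mul_conj' a
  unfold blaschkeFactor
  rw [div_mul_div_comm, ← neg_div, eq_div_iff (mul_ne_zero ha hz), sub_mul,
    div_mul_cancel₀ _ (mul_ne_zero ha hz)]
  linear_combination z * h

theorem norm_blaschkeFactor_sub_one_le {a z : ℂ} (ha : 0 < ‖a‖) (ha1 : ‖a‖ < 1)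
    (hz : 1 - (starRingEnd ℂ) a * z ≠ 0) :
    ‖blaschkeFactor a z - 1‖ ≤ (1 - ‖a‖) * ((1 + ‖z‖) / ‖1 - (starRingEnd ℂ) a * z‖) := by
  have hz' : 0 < ‖1 - (starRingEnd ℂ) a * z‖ := norm_pos_iff.2 hz
  rw [blaschkeFactor_sub_one (norm_pos_iff.1 ha) hz, norm_neg, norm_div, norm_mul, norm_mul]
  have h1 : ‖(1 - ‖a‖ : ℂ)‖ = 1 - ‖a‖ := by
    rw [← Complex.ofReal_one, ← Complex.ofReal_sub, Complex.norm_real, Real.norm_of_nonneg]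
    linarith
  have h2 : ‖a + ‖a‖ * z‖ ≤ ‖a‖ * (1 + ‖z‖) := by
    refine (norm_add_le _ _).trans_eq ?_
    simp [mul_add]
  rw [h1, mul_div_assoc]
  refine mul_le_mul_of_nonneg_left ?_ (by linarith)
  rw [div_le_div_iff₀ (by positivity) hz']
  calc ‖a + ‖a‖ * z‖ * ‖1 - (starRingEnd ℂ) a * z‖
      ≤ (‖a‖ * (1 + ‖z‖)) * ‖1 - (starRingEnd ℂ) a * z‖ := by gcongr
    _ = _ := by ring

/-- Since `conj ξ · ξ = 1`, the left side is the norm of `conj (ξ - a) · ξ`. Zeros far from `ξ`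
therefore keep the denominators away from `0`. -/
theorem norm_one_sub_conj_mul {ξ : ℂ} (hξ : ‖ξ‖ = 1) (a : ℂ) :
    ‖1 - (starRingEnd ℂ) a * ξ‖ = ‖a - ξ‖ := by
  have h : 1 - (starRingEnd ℂ) a * ξ = (starRingEnd ℂ) (ξ - a) * ξ := by
    rw [map_sub, sub_mul, Complex.conj_mul', hξ]; simp
  rw [h, norm_mul, hξ, mul_one, Complex.norm_conj, norm_sub_rev]

theorem half_le_norm_one_sub_conj_mul {ξ a z : ℂ} {δ : ℝ} (hξ : ‖ξ‖ = 1) (ha1 : ‖a‖ < 1)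
    (hδ : δ ≤ ‖a - ξ‖) (hz : z ∈ Metric.ball ξ (δ / 2)) :
    δ / 2 ≤ ‖1 - (starRingEnd ℂ) a * z‖ := by
  rw [← norm_one_sub_conj_mul hξ] at hδ
  have h1 : ‖(starRingEnd ℂ) a * (z - ξ)‖ ≤ δ / 2 := by
    rw [norm_mul, Complex.norm_conj]
    rw [mem_ball_iff_norm] at hz
    nlinarith [norm_nonneg (z - ξ), norm_nonneg a]
  have h2 := norm_sub_norm_le (1 - (starRingEnd ℂ) a * ξ) ((starRingEnd ℂ) a * (z - ξ))
  have h3 : 1 - (starRingEnd ℂ) a * ξ - (starRingEnd ℂ) a * (z - ξ)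
      = 1 - (starRingEnd ℂ) a * z := by ring
  rw [h3] at h2
  linarith

theorem norm_blaschkeFactor_sub_one_le_of_mem_ball {ξ a z : ℂ} {δ : ℝ} (hδ0 : 0 < δ)
    (hξ : ‖ξ‖ = 1) (ha : 0 < ‖a‖) (ha1 : ‖a‖ < 1) (hδ : δ ≤ ‖a - ξ‖)
    (hz : z ∈ Metric.ball ξ (δ / 2)) :
    ‖blaschkeFactor a z - 1‖ ≤ (1 - ‖a‖) * ((2 + δ / 2) / (δ / 2)) := by
  have h1 := half_le_norm_one_sub_conj_mul hξ ha1 hδ hz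
  have h2 : 1 - (starRingEnd ℂ) a * z ≠ 0 := norm_pos_iff.1 (by linarith)
  refine (norm_blaschkeFactor_sub_one_le ha ha1 h2).trans ?_
  have h3 : ‖z‖ ≤ 1 + δ / 2 := by
    rw [mem_ball_iff_norm] at hz
    have := norm_le_norm_add_norm_sub' z ξ
    linarith
  refine mul_le_mul_of_nonneg_left ?_ (by linarith)
  gcongr ?_ / ?_
  linarith

theorem differentiableOn_blaschkeFactor {a : ℂ} {s : Set ℂ}
    (h : ∀ z ∈ s, 1 - (starRingEnd ℂ) a * z ≠ 0) : DifferentiableOn ℂ (blaschkeFactor a) s := by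
  unfold blaschkeFactor
  refine DifferentiableOn.const_mul (DifferentiableOn.div ?_ ?_ h) _ <;> fun_prop

theorem norm_blaschkeFactor_eq_one {a ξ : ℂ} (hξ : ‖ξ‖ = 1) (ha : 0 < ‖a‖) (ha1 : ‖a‖ < 1) :
    ‖blaschkeFactor a ξ‖ = 1 := by
  have h : ‖a - ξ‖ ≠ 0 := by
    intro h
    rw [norm_eq_zero, sub_eq_zero] at h
    rw [h] at ha1
    linarith
  rw [blaschkeFactor, norm_mul, norm_div, norm_div, norm_one_sub_conj_mul hξ, div_self h]
  simp [ha.ne']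

/-- The right side is the Poisson kernel. Its positivity is the source of the monotonicity of the
argument of `B`. -/
theorem mul_logDeriv_blaschkeFactor {a ξ : ℂ} (hξ : ‖ξ‖ = 1) (ha : 0 < ‖a‖) (ha1 : ‖a‖ < 1) :
    ξ * logDeriv (blaschkeFactor a) ξ = (((1 - ‖a‖ ^ 2) / ‖a - ξ‖ ^ 2 : ℝ) : ℂ) := by
  have h : a - ξ ≠ 0 := by
    intro h
    rw [sub_eq_zero] at h
    rw [h] at ha1
    linarith
  have h' : 1 - (starRingEnd ℂ) a * ξ ≠ 0 := by
    rw [← norm_pos_iff, norm_one_sub_conj_mul hξ, norm_pos_iff]; exact h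
  have ha0 : a ≠ 0 := norm_pos_iff.1 ha
  have hd : HasDerivAt (blaschkeFactor a)
      ((‖a‖ : ℂ) / a * ((-1 * (1 - (starRingEnd ℂ) a * ξ) - (a - ξ) * (-((starRingEnd ℂ) a * 1)))
        / (1 - (starRingEnd ℂ) a * ξ) ^ 2)) ξ := by
    unfold blaschkeFactor
    exact ((((hasDerivAt_id ξ).const_sub a)).div
      (((hasDerivAt_id ξ).const_mul ((starRingEnd ℂ) a)).const_sub 1) h').const_mul _
  have hn : (‖a‖ : ℂ) ≠ 0 := by exact_mod_cast ha.ne'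
  rw [logDeriv_apply, hd.deriv, blaschkeFactor]
  have e1 : ((‖a - ξ‖ ^ 2 : ℝ) : ℂ) = (a - ξ) * ((starRingEnd ℂ) a - (starRingEnd ℂ) ξ) := by
    rw [← map_sub, Complex.mul_conj']; norm_cast
  have e2 : ((‖a‖ ^ 2 : ℝ) : ℂ) = a * (starRingEnd ℂ) a := by
    rw [Complex.mul_conj']; norm_cast
  have e3 : ξ * (starRingEnd ℂ) ξ = 1 := by
    rw [Complex.mul_conj', hξ]; norm_num
  have h2 : (starRingEnd ℂ) a - (starRingEnd ℂ) ξ ≠ 0 := by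
    rw [← map_sub]; exact (map_ne_zero _).2 h
  rw [Complex.ofReal_div, Complex.ofReal_sub, e1, e2, Complex.ofReal_one,
    eq_div_iff (mul_ne_zero h h2)]
  have e4 : 1 - (starRingEnd ℂ) a * ξ = -(ξ * ((starRingEnd ℂ) a - (starRingEnd ℂ) ξ)) := by
    linear_combination -e3
  have hξ0 : ξ ≠ 0 := norm_pos_iff.1 (by rw [hξ]; norm_num)
  rw [e4]
  field_simp
  linear_combination e3

/-! ### The infinite product near a point of the circle away from the zeros -/

section Product

variable {ι : Type*} {c : ℂ} {p : ℕ} {a : ι → ℂ} {ξ : ℂ} {δ : ℝ}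

theorem multipliableLocallyUniformlyOn_blaschkeFactor (ha : ∀ j, 0 < ‖a j‖ ∧ ‖a j‖ < 1)
    (hs : Summable fun j => 1 - ‖a j‖) (hξ : ‖ξ‖ = 1) (hδ0 : 0 < δ) (hδ : ∀ j, δ ≤ ‖a j - ξ‖) :
    MultipliableLocallyUniformlyOn (fun j => blaschkeFactor (a j)) (Metric.ball ξ (δ / 2)) := by
  have hne : ∀ j, ∀ z ∈ Metric.ball ξ (δ / 2), 1 - (starRingEnd ℂ) (a j) * z ≠ 0 := fun j z hz =>
    norm_pos_iff.1 (by linarith [half_le_norm_one_sub_conj_mul hξ (ha j).2 (hδ j) hz])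
  have h := Summable.multipliableLocallyUniformlyOn_one_add
    (f := fun j z => blaschkeFactor (a j) z - 1) (K := Metric.ball ξ (δ / 2)) Metric.isOpen_ball
    (hs.mul_right ((2 + δ / 2) / (δ / 2)))
    (Eventually.of_forall fun j z hz =>
      norm_blaschkeFactor_sub_one_le_of_mem_ball hδ0 hξ (ha j).1 (ha j).2 (hδ j) hz)
    (fun j => (differentiableOn_blaschkeFactor (hne j)).continuousOn.sub continuousOn_const)
  simpa using h

theorem analyticAt_tprod_blaschkeFactor (ha : ∀ j, 0 < ‖a j‖ ∧ ‖a j‖ < 1)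
    (hs : Summable fun j => 1 - ‖a j‖) (hξ : ‖ξ‖ = 1) (hδ0 : 0 < δ) (hδ : ∀ j, δ ≤ ‖a j - ξ‖) :
    AnalyticAt ℂ (fun z => ∏' j, blaschkeFactor (a j) z) ξ := by
  have hne : ∀ j, ∀ z ∈ Metric.ball ξ (δ / 2), 1 - (starRingEnd ℂ) (a j) * z ≠ 0 := fun j z hz =>
    norm_pos_iff.1 (by linarith [half_le_norm_one_sub_conj_mul hξ (ha j).2 (hδ j) hz])
  have h := (multipliableLocallyUniformlyOn_blaschkeFactor ha hs hξ hδ0 hδ).hasProdLocallyUniformlyOn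
  rw [hasProdLocallyUniformlyOn_iff_tendstoLocallyUniformlyOn] at h
  refine (TendstoLocallyUniformlyOn.differentiableOn h (Eventually.of_forall fun s => ?_)
    Metric.isOpen_ball).analyticAt (Metric.ball_mem_nhds ξ (by linarith))
  exact DifferentiableOn.fun_finsetProd fun j _ => differentiableOn_blaschkeFactor (hne j)

theorem multipliable_blaschkeFactor (ha : ∀ j, 0 < ‖a j‖ ∧ ‖a j‖ < 1)
    (hs : Summable fun j => 1 - ‖a j‖) (hξ : ‖ξ‖ = 1) (hδ0 : 0 < δ) (hδ : ∀ j, δ ≤ ‖a j - ξ‖) :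
    Multipliable fun j => blaschkeFactor (a j) ξ :=
  (multipliableLocallyUniformlyOn_blaschkeFactor ha hs hξ hδ0 hδ).multipliable
    (Metric.mem_ball_self (by linarith))

theorem norm_tprod_blaschkeFactor (ha : ∀ j, 0 < ‖a j‖ ∧ ‖a j‖ < 1)
    (hs : Summable fun j => 1 - ‖a j‖) (hξ : ‖ξ‖ = 1) (hδ0 : 0 < δ) (hδ : ∀ j, δ ≤ ‖a j - ξ‖) :
    ‖∏' j, blaschkeFactor (a j) ξ‖ = 1 := by
  rw [(multipliable_blaschkeFactor ha hs hξ hδ0 hδ).norm_tprod]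
  simp [fun j => norm_blaschkeFactor_eq_one hξ (ha j).1 (ha j).2]

theorem norm_blaschkeProd (hc : ‖c‖ = 1) (ha : ∀ j, 0 < ‖a j‖ ∧ ‖a j‖ < 1)
    (hs : Summable fun j => 1 - ‖a j‖) (hξ : ‖ξ‖ = 1) (hδ0 : 0 < δ) (hδ : ∀ j, δ ≤ ‖a j - ξ‖) :
    ‖blaschkeProd c p a ξ‖ = 1 := by
  rw [blaschkeProd, norm_mul, norm_tprod_blaschkeFactor ha hs hξ hδ0 hδ, norm_mul, norm_pow, hξ, hc]
  simp

/-- Logarithmic derivatives of the factors add up to `p` plus a convergent sum of Poisson kernels.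
As `p` may be `0`, strict positivity needs at least one `a j`. -/
theorem exists_mul_logDeriv_blaschkeProd [Nonempty ι] (hc : ‖c‖ = 1)
    (ha : ∀ j, 0 < ‖a j‖ ∧ ‖a j‖ < 1)
    (hs : Summable fun j => 1 - ‖a j‖) (hξ : ‖ξ‖ = 1) (hδ0 : 0 < δ) (hδ : ∀ j, δ ≤ ‖a j - ξ‖) :
    ∃ r : ℝ, 0 < r ∧ ξ * logDeriv (blaschkeProd c p a) ξ = r := by
  have hξ0 : ξ ≠ 0 := norm_pos_iff.1 (by rw [hξ]; norm_num)
  have hmem : ξ ∈ Metric.ball ξ (δ / 2) := Metric.mem_ball_self (by linarith)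
  have hne : ∀ j, ∀ z ∈ Metric.ball ξ (δ / 2), 1 - (starRingEnd ℂ) (a j) * z ≠ 0 := fun j z hz =>
    norm_pos_iff.1 (by linarith [half_le_norm_one_sub_conj_mul hξ (ha j).2 (hδ j) hz])
  have hprod : ∏' j, blaschkeFactor (a j) ξ ≠ 0 := norm_pos_iff.1
    (by rw [norm_tprod_blaschkeFactor ha hs hξ hδ0 hδ]; norm_num)
  set w : ι → ℝ := fun j => (1 - ‖a j‖ ^ 2) / ‖a j - ξ‖ ^ 2 with hw
  have hw0 : ∀ j, 0 < w j := fun j => by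
    have h1 : 0 < ‖a j - ξ‖ := hδ0.trans_le (hδ j)
    have h2 : 0 < 1 - ‖a j‖ ^ 2 := by nlinarith [ha j]
    simp only [hw]; positivity
  have hwle : ∀ j, w j ≤ (1 - ‖a j‖) * (2 / δ ^ 2) := fun j => by
    have h2 : 1 - ‖a j‖ ^ 2 ≤ (1 - ‖a j‖) * 2 := by nlinarith [ha j]
    calc w j ≤ ((1 - ‖a j‖) * 2) / δ ^ 2 := by
          simp only [hw]
          have := hδ j
          have := (ha j).2
          gcongr
      _ = _ := by ring
  have hws : Summable w := Summable.of_nonneg_of_le (fun j => (hw0 j).le) hwle (hs.mul_right _)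
  have hlog : ∀ j, logDeriv (blaschkeFactor (a j)) ξ = ξ⁻¹ * (w j : ℂ) := fun j => by
    rw [← mul_logDeriv_blaschkeFactor hξ (ha j).1 (ha j).2, inv_mul_cancel_left₀ hξ0]
  have hsum : Summable fun j => logDeriv (blaschkeFactor (a j)) ξ := by
    simp_rw [hlog]
    exact (Complex.hasSum_ofReal.2 hws.hasSum).summable.mul_left _
  have key := logDeriv_tprod_eq_tsum Metric.isOpen_ball hmem
    (fun j => norm_pos_iff.1 (by rw [norm_blaschkeFactor_eq_one hξ (ha j).1 (ha j).2]; norm_num))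
    (fun j => differentiableOn_blaschkeFactor (hne j)) hsum
    (multipliableLocallyUniformlyOn_blaschkeFactor ha hs hξ hδ0 hδ) hprod
  refine ⟨p + ∑' j, w j, ?_, ?_⟩
  · have := hws.tsum_pos (fun j => (hw0 j).le) (Classical.arbitrary ι) (hw0 _)
    positivity
  · have hc0 : c ≠ 0 := norm_pos_iff.1 (by rw [hc]; norm_num)
    have hd : DifferentiableAt ℂ (fun z => ∏' j, blaschkeFactor (a j) z) ξ :=
      (analyticAt_tprod_blaschkeFactor ha hs hξ hδ0 hδ).differentiableAt
    have : logDeriv (blaschkeProd c p a) ξ =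
        logDeriv (fun z => c * z ^ p) ξ + logDeriv (fun z => ∏' j, blaschkeFactor (a j) z) ξ :=
      logDeriv_mul ξ (mul_ne_zero hc0 (pow_ne_zero _ hξ0)) hprod (by fun_prop) hd
    rw [this, key, logDeriv_const_mul _ _ hc0, logDeriv_fun_pow differentiableAt_id]
    simp_rw [hlog]
    rw [tsum_mul_left, ← Complex.ofReal_tsum]
    simp only [logDeriv_id']
    push_cast
    field_simp

theorem analyticAt_blaschkeProd (ha : ∀ j, 0 < ‖a j‖ ∧ ‖a j‖ < 1)
    (hs : Summable fun j => 1 - ‖a j‖) (hξ : ‖ξ‖ = 1) (hδ0 : 0 < δ) (hδ : ∀ j, δ ≤ ‖a j - ξ‖) :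
    AnalyticAt ℂ (blaschkeProd c p a) ξ := by
  unfold blaschkeProd
  exact (by fun_prop : AnalyticAt ℂ (fun z => c * z ^ p) ξ).mul
    (analyticAt_tprod_blaschkeFactor ha hs hξ hδ0 hδ)

theorem blaschkeProd_eq_zero {j : ι} : blaschkeProd c p a (a j) = 0 := by
  rw [blaschkeProd, tprod_of_exists_eq_zero ⟨j, by simp [blaschkeFactor]⟩, mul_zero]

/-- An absolutely convergent product of nonzero factors is nonzero; `z ≠ 0` takes care of `z ^ p`.
-/
theorem blaschkeProd_ne_zero (hc : ‖c‖ = 1) (ha : ∀ j, 0 < ‖a j‖ ∧ ‖a j‖ < 1)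
    (hs : Summable fun j => 1 - ‖a j‖) {z : ℂ} (hz1 : ‖z‖ < 1) (hz0 : z ≠ 0) (hz : ∀ j, a j ≠ z) :
    blaschkeProd c p a z ≠ 0 := by
  have hbd : ∀ j, 1 - ‖z‖ ≤ ‖1 - (starRingEnd ℂ) (a j) * z‖ := fun j => by
    have h1 := norm_sub_norm_le (1 : ℂ) ((starRingEnd ℂ) (a j) * z)
    rw [norm_one, norm_mul, Complex.norm_conj] at h1
    nlinarith [norm_nonneg z, (ha j).2]
  have hne : ∀ j, 1 - (starRingEnd ℂ) (a j) * z ≠ 0 := fun j =>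
    norm_pos_iff.1 (by linarith [hbd j])
  have hprod : ∏' j, (1 + (blaschkeFactor (a j) z - 1)) ≠ 0 := by
    refine tprod_one_add_ne_zero_of_summable (fun j => ?_) ?_
    · have h1 : a j ≠ 0 := norm_pos_iff.1 (ha j).1
      have h2 : a j - z ≠ 0 := sub_ne_zero.2 (hz j)
      have h3 : (‖a j‖ : ℂ) ≠ 0 := by exact_mod_cast (ha j).1.ne'
      rw [add_sub_cancel, blaschkeFactor]
      exact mul_ne_zero (div_ne_zero h3 h1) (div_ne_zero h2 (hne j))
    · refine Summable.of_nonneg_of_le (fun _ => norm_nonneg _) (fun j => ?_)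
        (hs.mul_right ((1 + ‖z‖) / (1 - ‖z‖)))
      refine (norm_blaschkeFactor_sub_one_le (ha j).1 (ha j).2 (hne j)).trans ?_
      have := (ha j).2
      have := hbd j
      have : 0 < 1 - ‖z‖ := by linarith
      gcongr
  simp only [add_sub_cancel] at hprod
  have hc0 : c ≠ 0 := norm_pos_iff.1 (by rw [hc]; norm_num)
  exact mul_ne_zero (mul_ne_zero hc0 (pow_ne_zero _ hz0)) hprod

end Product

/-! ### Regular points are not limits of zeros -/

section Regular

variable {B : ℂ → ℂ} {ι : Type*} {c : ℂ} {p : ℕ} {a : ι → ℂ}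

/-- If zeros came arbitrarily close to `ξ`, the analytic extension would have a non-isolated zero at
`ξ` and vanish nearby, so the product would vanish on a nonempty open subset of the disc. But its
zeros are countably many. -/
theorem exists_le_norm_sub_of_notMem_singularSet [Countable ι] (hc : ‖c‖ = 1)
    (ha : ∀ j, 0 < ‖a j‖ ∧ ‖a j‖ < 1) (hs : Summable fun j => 1 - ‖a j‖)
    (hB : ∀ z ∈ Metric.ball (0 : ℂ) 1, B z = blaschkeProd c p a z) {ξ : Circle}
    (hξ : ξ ∉ singularSet B) : ∃ δ > 0, ∀ j, δ ≤ ‖a j - ξ‖ := by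
  by_contra! hcon
  simp only [singularSet, mem_ofPred_eq, not_not] at hξ
  obtain ⟨g, hg, hgB⟩ := hξ
  rw [Filter.EventuallyEq, eventually_nhdsWithin_iff, Metric.eventually_nhds_iff] at hgB
  obtain ⟨ε, hε, hgε⟩ := hgB
  have hfreq : ∃ᶠ z in 𝓝[≠] (ξ : ℂ), g z = 0 := by
    rw [frequently_nhdsWithin_iff, Metric.nhds_basis_ball.frequently_iff]
    intro r hr
    obtain ⟨j, hj⟩ := hcon (min r ε) (lt_min hr hε)
    have hd : dist (a j) (ξ : ℂ) < min r ε := by rwa [dist_eq_norm]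
    refine ⟨a j, hd.trans_le (min_le_left _ _), ?_, fun h => ?_⟩
    · have hmem : a j ∈ Metric.ball (0 : ℂ) 1 := by simpa using (ha j).2
      rw [hgε (hd.trans_le (min_le_right _ _)) hmem, hB _ hmem, blaschkeProd_eq_zero]
    · have h1 := (ha j).2
      rw [mem_singleton_iff.1 h, Circle.norm_coe] at h1
      exact lt_irrefl _ h1
  have hzero := hg.frequently_zero_iff_eventually_zero.1 hfreq
  rw [Metric.eventually_nhds_iff] at hzero
  obtain ⟨ε', hε', hgε'⟩ := hzero
  have hU : IsOpen (Metric.ball (ξ : ℂ) (min ε ε') ∩ Metric.ball (0 : ℂ) 1) :=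
    Metric.isOpen_ball.inter Metric.isOpen_ball
  have hne : (Metric.ball (ξ : ℂ) (min ε ε') ∩ Metric.ball (0 : ℂ) 1).Nonempty := by
    have hcl : (ξ : ℂ) ∈ closure (Metric.ball (0 : ℂ) 1) := by
      rw [closure_ball _ one_ne_zero]; simp [Circle.norm_coe]
    exact mem_closure_iff_nhds.1 hcl _ (Metric.ball_mem_nhds _ (lt_min hε hε'))
  -- A countable set has dense complement in the plane, so some point of the open set is neither `0`
  -- nor an `a j`.
  have hcount : (range a ∪ {0}).Countable := (countable_range a).union (countable_singleton 0)
  obtain ⟨z, hz, hz'⟩ := (hcount.dense_compl ℝ).inter_open_nonempty _ hU hne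
  have hd : dist z (ξ : ℂ) < min ε ε' := hz.1
  have hz1 : ‖z‖ < 1 := by simpa using hz.2
  simp only [mem_compl_iff, mem_union, mem_range, mem_singleton_iff, not_or, not_exists] at hz'
  refine blaschkeProd_ne_zero (p := p) hc ha hs hz1 hz'.2 hz'.1 ?_
  rw [← hB z hz.2, ← hgε (hd.trans_le (min_le_left _ _)) hz.2]
  exact hgε' (hd.trans_le (min_le_right _ _))

theorem boundaryValue_eq [Countable ι] (hc : ‖c‖ = 1)
    (ha : ∀ j, 0 < ‖a j‖ ∧ ‖a j‖ < 1) (hs : Summable fun j => 1 - ‖a j‖)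
    (hB : ∀ z ∈ Metric.ball (0 : ℂ) 1, B z = blaschkeProd c p a z) {ξ : Circle}
    (hξ : ξ ∉ singularSet B) : boundaryValue B ξ = blaschkeProd c p a ξ := by
  obtain ⟨δ, hδ0, hδ⟩ := exists_le_norm_sub_of_notMem_singularSet hc ha hs hB hξ
  have han : AnalyticAt ℂ (blaschkeProd c p a) (ξ : ℂ) :=
    analyticAt_blaschkeProd ha hs (Circle.norm_coe ξ) hδ0 hδ
  refine extendFrom_eq ?_ ?_
  · rw [closure_ball _ one_ne_zero]; simp [Circle.norm_coe]
  · refine (han.continuousAt.tendsto.mono_left nhdsWithin_le_nhds).congr' ?_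
    filter_upwards [self_mem_nhdsWithin] with z hz using (hB z hz).symm

/-- With no factors, `B` is the monomial `c z ^ p`, which is entire. -/
theorem nonempty_of_singularSet_nonempty [Nonempty (singularSet B)]
    (hB : ∀ z ∈ Metric.ball (0 : ℂ) 1, B z = blaschkeProd c p a z) : Nonempty ι := by
  by_contra hι
  rw [not_nonempty_iff] at hι
  obtain ⟨ξ, hξ⟩ := ‹Nonempty (singularSet B)›
  refine hξ ⟨fun z => c * z ^ p, by fun_prop, ?_⟩
  filter_upwards [self_mem_nhdsWithin] with z hz
  rw [hB z hz, blaschkeProd, tprod_empty, mul_one]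

end Regular

/-! ### The argument of `B` along a regular arc -/

/-- On an open arc of regular points, a Blaschke product with singularities has a continuous
strictly increasing argument. -/
theorem exists_continuous_argument {B : ℂ → ℂ} (hB : IsBlaschkeProduct B)
    (hne : (singularSet B).Nonempty) {α β : ℝ} (hαβ : α < β)
    (hreg : ∀ t ∈ Ioo α β, Circle.exp t ∉ singularSet B) :
    ∃ φ : ℝ → ℝ, ContinuousOn φ (Ioo α β) ∧ StrictMonoOn φ (Ioo α β) ∧
      ∀ t ∈ Ioo α β, boundaryValue B (Circle.exp t) = Circle.exp (φ t) := by
  obtain ⟨c, p, S, a, hc, ha, hs, hB⟩ := hB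
  change ∀ z ∈ Metric.ball (0 : ℂ) 1, B z = blaschkeProd c p a z at hB
  have : Nonempty (singularSet B) := hne.to_subtype
  have : Nonempty S := nonempty_of_singularSet_nonempty hB
  set F := blaschkeProd c p a with hF
  set e : ℝ → ℂ := fun t => (Circle.exp t : ℂ) with he
  have hen : ∀ t, ‖e t‖ = 1 := fun t => Circle.norm_coe _
  have hδ : ∀ t ∈ Ioo α β, ∃ δ > 0, ∀ j, δ ≤ ‖a j - e t‖ := fun t ht =>
    exists_le_norm_sub_of_notMem_singularSet hc ha hs hB (hreg t ht)
  have han : ∀ t ∈ Ioo α β, AnalyticAt ℂ F (e t) := fun t ht => by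
    obtain ⟨δ, hδ0, hδ⟩ := hδ t ht
    exact analyticAt_blaschkeProd ha hs (hen t) hδ0 hδ
  have hnorm : ∀ t ∈ Ioo α β, ‖F (e t)‖ = 1 := fun t ht => by
    obtain ⟨δ, hδ0, hδ⟩ := hδ t ht
    exact norm_blaschkeProd hc ha hs (hen t) hδ0 hδ
  have hF0 : ∀ t ∈ Ioo α β, F (e t) ≠ 0 := fun t ht =>
    norm_pos_iff.1 (by rw [hnorm t ht]; norm_num)
  -- This is the derivative of the argument of `F (e t)`. The quantity is already real; `re` only
  -- changes its type.
  set ψ : ℝ → ℝ := fun t => (e t * logDeriv F (e t)).re with hψ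
  have hpos : ∀ t ∈ Ioo α β, 0 < ψ t ∧ e t * logDeriv F (e t) = ψ t := fun t ht => by
    obtain ⟨δ, hδ0, hδ⟩ := hδ t ht
    obtain ⟨r, hr, h⟩ := exists_mul_logDeriv_blaschkeProd (p := p) hc ha hs (hen t) hδ0 hδ
    simp only [hψ, hF, h, Complex.ofReal_re, and_true]
    exact hr
  have hecont : Continuous e := by
    simp only [he, Circle.coe_exp]; fun_prop
  have hψc : ContinuousOn ψ (Ioo α β) := fun t ht => by
    have h1 : ContinuousAt (logDeriv F) (e t) :=
      (han t ht).deriv.continuousAt.div (han t ht).continuousAt (hF0 t ht)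
    have h2 : ContinuousAt (fun s => logDeriv F (e s)) t :=
      ContinuousAt.comp (f := e) (g := logDeriv F) h1 hecont.continuousAt
    exact (Complex.continuous_re.continuousAt.comp
      (hecont.continuousAt.mul h2)).continuousWithinAt
  obtain ⟨t₀, ht₀⟩ := nonempty_Ioo.2 hαβ
  obtain ⟨φ₀, hφ₀⟩ : ∃ s : ℝ, Circle.exp s = ⟨F (e t₀), by simpa [Submonoid.unitSphere] using hnorm t₀ ht₀⟩ :=
    ⟨_, Circle.exp_arg _⟩
  have hφ₀' : Complex.exp (φ₀ * Complex.I) = F (e t₀) := by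
    rw [← Circle.coe_exp, hφ₀]
  set φ : ℝ → ℝ := fun t => φ₀ + ∫ s in t₀..t, ψ s with hφ
  have hφd : ∀ t ∈ Ioo α β, HasDerivAt φ (ψ t) t := fun t ht => by
    refine HasDerivAt.const_add _ (intervalIntegral.integral_hasDerivAt_right ?_ ?_ ?_)
    · exact (hψc.mono ((convex_Ioo α β).ordConnected.uIcc_subset ht₀ ht)).intervalIntegrable
    · exact hψc.stronglyMeasurableAtFilter isOpen_Ioo t ht
    · exact hψc.continuousAt (isOpen_Ioo.mem_nhds ht)
  have hφc : ContinuousOn φ (Ioo α β) := fun t ht => (hφd t ht).continuousAt.continuousWithinAt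
  refine ⟨φ, hφc, ?_, fun t ht => ?_⟩
  · refine strictMonoOn_of_deriv_pos (convex_Ioo α β) hφc fun t ht => ?_
    rw [interior_Ioo] at ht
    rw [(hφd t ht).deriv]
    exact (hpos t ht).1
  · rw [boundaryValue_eq hc ha hs hB (hreg t ht), Circle.coe_exp (φ t)]
    -- Dividing `F (e s)` by `e^{iφ(s)}` gives a function with derivative `0`, hence constant on the
    -- arc, and `φ₀` was chosen so that its value at `t₀` is `1`.
    have hd : ∀ s ∈ Ioo α β, HasDerivAt
        (fun s : ℝ => F (e s) * Complex.exp (-(φ s * Complex.I))) 0 s := fun s hs => by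
      have h1 : HasDerivAt e (e s * Complex.I) s := by
        have := ((Complex.ofRealCLM.hasDerivAt (x := s)).mul_const Complex.I).cexp
        simpa [he, Circle.coe_exp] using this
      have h2 : HasDerivAt (fun s => F (e s)) (deriv F (e s) * (e s * Complex.I)) s :=
        (han s hs).differentiableAt.hasDerivAt.comp s h1
      have h3 := (((hφd s hs).ofReal_comp).mul_const Complex.I).neg.cexp
      refine (h2.mul h3).congr_deriv ?_
      have h4 := (hpos s hs).2
      rw [logDeriv_apply] at h4
      have h5 : deriv F (e s) * e s = ψ s * F (e s) := by
        rw [← h4]; field_simp [hF0 s hs]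
      simp only [Pi.neg_apply]
      linear_combination (Complex.I * Complex.exp (-(φ s * Complex.I))) * h5
    have hconst : F (e t) * Complex.exp (-(φ t * Complex.I))
        = F (e t₀) * Complex.exp (-(φ t₀ * Complex.I)) :=
      by
      exact isOpen_Ioo.is_const_of_deriv_eq_zero isPreconnected_Ioo
        (fun s hs => (hd s hs).differentiableAt.differentiableWithinAt)
        (fun s hs => (hd s hs).deriv) ht ht₀
    have h0 : F (e t₀) * Complex.exp (-(φ t₀ * Complex.I)) = 1 := by
      simp [hφ, ← hφ₀', ← Complex.exp_add]
    rw [h0, Complex.exp_neg] at hconst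
    change F (e t) = _
    field_simp at hconst
    exact hconst

/-! ### Open intervals and their intersections with cosets of `ℤ` -/

section Intervals

theorem IsPreconnected.eq_Iio_csSup {E : Set ℝ} (hE : IsPreconnected E) (ho : IsOpen E)
    (h₁ : ¬BddBelow E) (h₂ : BddAbove E) : E = Iio (sSup E) := by
  refine Subset.antisymm (fun x hx => ?_) (hE.Iio_csSup_subset h₁ h₂)
  obtain ⟨l, u, ⟨hl, hu⟩, hlu⟩ := mem_nhds_iff_exists_Ioo_subset.1 (ho.mem_nhds hx)
  obtain ⟨y, hxy, hyu⟩ := exists_between hu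
  exact hxy.trans_le (le_csSup h₂ (hlu ⟨hl.trans hxy, hyu⟩))

theorem IsPreconnected.eq_Ioi_csInf {E : Set ℝ} (hE : IsPreconnected E) (ho : IsOpen E)
    (h₁ : BddBelow E) (h₂ : ¬BddAbove E) : E = Ioi (sInf E) := by
  refine Subset.antisymm (fun x hx => ?_) (hE.Ioi_csInf_subset h₁ h₂)
  obtain ⟨l, u, ⟨hl, hu⟩, hlu⟩ := mem_nhds_iff_exists_Ioo_subset.1 (ho.mem_nhds hx)
  obtain ⟨y, hly, hyx⟩ := exists_between hl
  exact (csInf_le h₁ (hlu ⟨hly, hyx.trans hu⟩)).trans_lt hyx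

theorem IsPreconnected.eq_Ioo_csInf_csSup {E : Set ℝ} (hE : IsPreconnected E) (ho : IsOpen E)
    (h₁ : BddBelow E) (h₂ : BddAbove E) : E = Ioo (sInf E) (sSup E) := by
  rcases E.eq_empty_or_nonempty with rfl | hne
  · simp
  refine Subset.antisymm (fun x hx => ?_) fun x hx => ?_
  · obtain ⟨l, u, ⟨hl, hu⟩, hlu⟩ := mem_nhds_iff_exists_Ioo_subset.1 (ho.mem_nhds hx)
    obtain ⟨y, hly, hyx⟩ := exists_between hl
    obtain ⟨z, hxz, hzu⟩ := exists_between hu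
    exact ⟨(csInf_le h₁ (hlu ⟨hly, hyx.trans hu⟩)).trans_lt hyx,
      hxz.trans_le (le_csSup h₂ (hlu ⟨hl.trans hxz, hzu⟩))⟩
  · obtain ⟨y, hy, hyx⟩ := exists_lt_of_csInf_lt hne hx.1
    obtain ⟨z, hz, hxz⟩ := exists_lt_of_lt_csSup hne hx.2
    exact hE.ordConnected.out hy hz ⟨hyx.le, hxz.le⟩

theorem encard_setOf_add_int_mem_Ioo (u v s : ℝ) :
    {n : ℤ | s + n ∈ Ioo u v}.encard = ((⌈v - s⌉ - ⌊u - s⌋ - 1).toNat : ℕ∞) := by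
  have h : {n : ℤ | s + n ∈ Ioo u v} = (Finset.Ioo ⌊u - s⌋ ⌈v - s⌉ : Finset ℤ) := by
    ext n
    simp only [mem_ofPred_eq, mem_Ioo, Finset.coe_Ioo, Int.floor_lt, Int.lt_ceil]
    constructor <;> rintro ⟨h1, h2⟩ <;> constructor <;> linarith
  rw [h, encard_coe_eq_coe_finsetCard, Int.card_Ioo]

/-- A bounded open interval is determined, up to translation by an integer, by the number of points
it shares with each coset of `ℤ`. -/
theorem exists_int_translate_of_encard_eq {u v u' v' : ℝ} (huv : u < v) (huv' : u' < v')
    (h : ∀ s : ℝ, {n : ℤ | s + n ∈ Ioo u v}.encard = {n : ℤ | s + n ∈ Ioo u' v'}.encard) :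
    ∃ m : ℤ, u' = u + m ∧ v' = v + m := by
  -- Both intervals are nonempty, so the truncation in `toNat` never acts and the counts give an
  -- equality of integers.
  have hf : ∀ s : ℝ, ⌈v - s⌉ - ⌊u - s⌋ = ⌈v' - s⌉ - ⌊u' - s⌋ := fun s => by
    have h1 := h s
    rw [encard_setOf_add_int_mem_Ioo, encard_setOf_add_int_mem_Ioo, Nat.cast_inj] at h1
    have h2 : ⌊u - s⌋ < ⌈v - s⌉ := Int.floor_lt_ceil_of_lt (by linarith)
    have h3 : ⌊u' - s⌋ < ⌈v' - s⌉ := Int.floor_lt_ceil_of_lt (by linarith)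
    omega
  -- just to the right of `u`, only the term `⌊u - s⌋` can jump
  have hceil : ∀ x : ℝ, ∀ᶠ ε in 𝓝[>] (0 : ℝ), ⌈x - ε⌉ = ⌈x⌉ := fun x => by
    have hx : (⌈x⌉ : ℝ) - 1 < x := by linarith [Int.ceil_lt_add_one x]
    have : ∀ᶠ ε in 𝓝 (0 : ℝ), ε < x - (⌈x⌉ - 1) := eventually_lt_nhds (by linarith)
    filter_upwards [nhdsWithin_le_nhds this, self_mem_nhdsWithin] with ε h1 h2
    rw [Int.ceil_eq_iff]
    have h2' : 0 < ε := h2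
    exact ⟨by linarith, by linarith [Int.le_ceil x]⟩
  have hfloor : ∀ x : ℝ, (⌊x⌋ : ℝ) ≠ x → ∀ᶠ ε in 𝓝[>] (0 : ℝ), ⌊x - ε⌋ = ⌊x⌋ := fun x hx => by
    have hx : (⌊x⌋ : ℝ) < x := (Int.floor_le x).lt_of_ne hx
    have : ∀ᶠ ε in 𝓝 (0 : ℝ), ε < x - ⌊x⌋ := eventually_lt_nhds (by linarith)
    filter_upwards [nhdsWithin_le_nhds this, self_mem_nhdsWithin] with ε h1 h2
    rw [Int.floor_eq_iff]
    have h2' : 0 < ε := h2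
    exact ⟨by linarith, by linarith [Int.lt_floor_add_one x]⟩
  -- Compare `hf` at `s = u` and `s = u + ε`: the term `⌊u - s⌋` drops from `0` to `-1`, while the
  -- other three are unchanged if `u' - u` is not an integer.
  have hm : (⌊u' - u⌋ : ℝ) = u' - u := by
    by_contra hne
    obtain ⟨ε, ⟨⟨h1, h2⟩, h3⟩, h4, h5⟩ := ((((hceil (v - u)).and (hceil (v' - u))).and
      (hfloor (u' - u) hne)).and ((eventually_mem_nhdsWithin (a := (0 : ℝ)) (s := Ioi 0)).and
      (nhdsWithin_le_nhds (eventually_lt_nhds one_pos)))).exists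
    have h6 := hf u
    have h7 := hf (u + ε)
    have h8 : ⌊u - (u + ε)⌋ = -1 := by
      rw [Int.floor_eq_iff]
      have h4' : 0 < ε := h4
      push_cast
      exact ⟨by linarith, by linarith⟩
    rw [h8, ← sub_sub, ← sub_sub, ← sub_sub, h1, h2, h3] at h7
    simp only [sub_self, Int.floor_zero] at h6
    omega
  set m := ⌊u' - u⌋
  have hu' : u' = u + m := by linarith
  -- Taking `s = v` gives `v' - v ≤ m`, and taking `s = v'` gives the reverse inequality.
  have hc : ∀ s : ℝ, ⌈v' - s⌉ = ⌈v - s⌉ + m := fun s => by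
    have h1 := hf s
    have h2 : ⌊u' - s⌋ = ⌊u - s⌋ + m := by
      rw [hu', ← Int.floor_add_intCast]; congr 1; ring
    omega
  refine ⟨m, hu', le_antisymm ?_ ?_⟩
  · have h1 := hc v
    rw [sub_self, Int.ceil_zero, zero_add] at h1
    have := Int.le_ceil (v' - v)
    rw [h1] at this
    linarith
  · have h1 := hc v'
    rw [sub_self, Int.ceil_zero] at h1
    have h2 : ⌈v - v'⌉ = -m := by omega
    have := Int.le_ceil (v - v')
    rw [h2] at this
    push_cast at this
    linarith

end Intervals

/-! ### Types of arcs in terms of the image of the argument -/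

theorem Set.Finite.notMem_derivedSet {A U : Set ℝ} {x : ℝ} (h : (A ∩ U).Finite) (hU : U ∈ 𝓝 x) :
    x ∉ derivedSet A := by
  rw [mem_derivedSet, accPt_iff_nhds]
  push Not
  refine ⟨U ∩ ((A ∩ U) \ {x})ᶜ, inter_mem hU ?_, ?_⟩
  · exact (h.subset sdiff_subset).isClosed.isOpen_compl.mem_nhds (by simp)
  · rintro y ⟨⟨hyU, hy⟩, hyA⟩
    by_contra hne
    exact hy ⟨⟨hyA, hyU⟩, hne⟩

/-- `φ` is a continuous, strictly increasing argument of `B` along the arc from `e^{iα}` to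
`e^{iβ}`. -/
structure IsArgumentOn (B : ℂ → ℂ) (α β : ℝ) (φ : ℝ → ℝ) : Prop where
  lt : α < β
  cont : ContinuousOn φ (Ioo α β)
  mono : StrictMonoOn φ (Ioo α β)
  eq : ∀ t ∈ Ioo α β, boundaryValue B (Circle.exp t) = Circle.exp (φ t)

namespace IsArgumentOn

variable {B : ℂ → ℂ} {α β : ℝ} {φ : ℝ → ℝ}

theorem nonempty (h : IsArgumentOn B α β φ) : (φ '' Ioo α β).Nonempty :=
  (nonempty_Ioo.2 h.lt).image φ

theorem isPreconnected (h : IsArgumentOn B α β φ) : IsPreconnected (φ '' Ioo α β) :=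
  isPreconnected_Ioo.image φ h.cont

theorem isOpen (h : IsArgumentOn B α β φ) : IsOpen (φ '' Ioo α β) := by
  rw [isOpen_iff_mem_nhds]
  rintro _ ⟨t, ht, rfl⟩
  obtain ⟨t₁, h1, h1'⟩ := exists_between ht.1
  obtain ⟨t₂, h2, h2'⟩ := exists_between ht.2
  have m1 : t₁ ∈ Ioo α β := ⟨h1, h1'.trans ht.2⟩
  have m2 : t₂ ∈ Ioo α β := ⟨ht.1.trans h2, h2'⟩
  refine mem_of_superset (Icc_mem_nhds (h.mono m1 ht h1') (h.mono ht m2 h2)) ?_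
  exact h.isPreconnected.ordConnected.out (mem_image_of_mem _ m1) (mem_image_of_mem _ m2)

theorem add_int (h : IsArgumentOn B α β φ) (n : ℤ) :
    IsArgumentOn B α β fun t => φ t + n * (2 * Real.pi) where
  lt := h.lt
  cont := h.cont.add continuousOn_const
  mono := fun s hs t ht hst => by simpa using h.mono hs ht hst
  eq := fun t ht => by
    rw [h.eq t ht]
    congr 1
    exact (Circle.exp_eq_exp.2 ⟨n, rfl⟩).symm

theorem arcSolutions_eq (h : IsArgumentOn B α β φ) (s : ℝ) :
    arcSolutions B α β (Circle.exp s) =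
      {t ∈ Ioo α β | ∃ n : ℤ, φ t = s + n * (2 * Real.pi)} := by
  ext t
  simp only [arcSolutions, mem_sep_iff]
  refine and_congr_right fun ht => ?_
  rw [h.eq t ht, Circle.coe_inj, Circle.exp_eq_exp]

theorem arcSolutions_one (h : IsArgumentOn B α β φ) :
    arcSolutions B α β 1 = {t ∈ Ioo α β | ∃ n : ℤ, φ t = n * (2 * Real.pi)} := by
  simpa using h.arcSolutions_eq 0

/-- As `φ` is injective, counting solutions on the arc amounts to counting points of `s + 2πℤ` in
the image of `φ`. -/
theorem encard_arcSolutions (h : IsArgumentOn B α β φ) (s : ℝ) :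
    (arcSolutions B α β (Circle.exp s)).encard =
      {n : ℤ | s + n * (2 * Real.pi) ∈ φ '' Ioo α β}.encard := by
  rw [h.arcSolutions_eq, ← InjOn.encard_image (f := φ) (h.mono.injOn.mono (sep_subset _ _)),
    ← InjOn.encard_image (f := fun n : ℤ => s + n * (2 * Real.pi)) (s := {n : ℤ | _})]
  · congr 1
    ext y
    constructor
    · rintro ⟨t, ⟨ht, n, hn⟩, rfl⟩
      exact ⟨n, ⟨t, ht, hn⟩, hn.symm⟩
    · rintro ⟨n, ⟨t, ht, hn⟩, rfl⟩
      exact ⟨t, ⟨ht, n, hn⟩, hn⟩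
  · intro m _ n _ hmn
    simpa [Real.pi_ne_zero] using hmn

theorem arcSolutions_eq_empty {w : ℂ} (h : IsArgumentOn B α β φ) (hw : ‖w‖ ≠ 1) :
    arcSolutions B α β w = ∅ := by
  refine eq_empty_of_forall_notMem fun t ht => hw ?_
  rw [← ht.2, h.eq t ht.1, Circle.norm_coe]

/-- A bounded set contains finitely many multiples of `2π`, and `φ` takes each at most once. -/
theorem finite_inter (h : IsArgumentOn B α β φ) {U : Set ℝ} (h₁ : BddBelow (φ '' (Ioo α β ∩ U)))
    (h₂ : BddAbove (φ '' (Ioo α β ∩ U))) : (arcSolutions B α β 1 ∩ U).Finite := by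
  obtain ⟨l, hl⟩ := h₁
  obtain ⟨u, hu⟩ := h₂
  rw [h.arcSolutions_one]
  have hpi := Real.two_pi_pos
  have hinj : InjOn φ ({t ∈ Ioo α β | ∃ n : ℤ, φ t = n * (2 * Real.pi)} ∩ U) :=
    h.mono.injOn.mono (inter_subset_left.trans (sep_subset _ _))
  refine Finite.of_finite_image ?_ hinj
  refine ((finite_Icc ⌈l / (2 * Real.pi)⌉ ⌊u / (2 * Real.pi)⌋).image
    fun n : ℤ => n * (2 * Real.pi)).subset ?_
  rintro _ ⟨t, ⟨⟨ht, n, hn⟩, htU⟩, rfl⟩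
  have h1 := hl (mem_image_of_mem φ ⟨ht, htU⟩)
  have h2 := hu (mem_image_of_mem φ ⟨ht, htU⟩)
  rw [hn] at h1 h2
  exact ⟨n, ⟨Int.ceil_le.2 ((div_le_iff₀ hpi).2 h1), Int.le_floor.2 ((le_div_iff₀ hpi).2 h2)⟩,
    hn.symm⟩

theorem derivedSet_subset (h : IsArgumentOn B α β φ) :
    derivedSet (arcSolutions B α β 1) ⊆ {α, β} := by
  intro x hx
  by_contra hne
  simp only [mem_insert_iff, mem_singleton_iff, not_or] at hne
  by_cases hx1 : x ∈ Ioo α β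
  · obtain ⟨t₁, h1, h1'⟩ := exists_between hx1.1
    obtain ⟨t₂, h2, h2'⟩ := exists_between hx1.2
    have m1 : t₁ ∈ Ioo α β := ⟨h1, h1'.trans hx1.2⟩
    have m2 : t₂ ∈ Ioo α β := ⟨hx1.1.trans h2, h2'⟩
    refine (h.finite_inter (U := Icc t₁ t₂) ⟨φ t₁, ?_⟩ ⟨φ t₂, ?_⟩).notMem_derivedSet
      (Icc_mem_nhds h1' h2) hx
    · rintro _ ⟨t, ⟨ht, ht'⟩, rfl⟩
      exact h.mono.monotoneOn m1 ht ht'.1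
    · rintro _ ⟨t, ⟨ht, ht'⟩, rfl⟩
      exact h.mono.monotoneOn ht m2 ht'.2
  · have hx2 : x ∈ (Icc α β)ᶜ := fun hx2 =>
      hx1 ⟨lt_of_le_of_ne hx2.1 (Ne.symm hne.1), lt_of_le_of_ne hx2.2 hne.2⟩
    have he : Ioo α β ∩ (Icc α β)ᶜ = ∅ :=
      eq_empty_of_forall_notMem fun t ht => ht.2 (Ioo_subset_Icc_self ht.1)
    exact (h.finite_inter (U := (Icc α β)ᶜ) (by simp [he]) (by simp [he])).notMem_derivedSet
      (isClosed_Icc.isOpen_compl.mem_nhds hx2) hx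

/-- By monotonicity, `φ` can be unbounded below only near `α`; there the intermediate value theorem
makes it hit multiples of `2π` arbitrarily close to `α`. -/
theorem left_mem_derivedSet_iff (h : IsArgumentOn B α β φ) :
    α ∈ derivedSet (arcSolutions B α β 1) ↔ ¬BddBelow (φ '' Ioo α β) := by
  have hpi := Real.two_pi_pos
  obtain ⟨t, ht⟩ := nonempty_Ioo.2 h.lt
  constructor
  · intro hx hb
    refine (h.finite_inter (U := Iio t) (hb.mono (image_mono inter_subset_left))
      ⟨φ t, ?_⟩).notMem_derivedSet (Iio_mem_nhds ht.1) hx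
    rintro _ ⟨s, ⟨hs, hs'⟩, rfl⟩
    exact (h.mono hs ht hs').le
  · intro hb
    rw [mem_derivedSet, accPt_iff_nhds]
    intro U hU
    obtain ⟨l, u, ⟨hl, hu⟩, hlu⟩ := mem_nhds_iff_exists_Ioo_subset.1 hU
    obtain ⟨t', ht'α, ht'⟩ := exists_between (lt_min hu h.lt)
    have m' : t' ∈ Ioo α β := ⟨ht'α, ht'.trans_le (min_le_right _ _)⟩
    obtain ⟨n, hn⟩ := exists_int_lt (φ t' / (2 * Real.pi))
    rw [lt_div_iff₀ hpi] at hn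
    rw [not_bddBelow_iff] at hb
    obtain ⟨_, ⟨r, hr, rfl⟩, hrn⟩ := hb (n * (2 * Real.pi))
    obtain ⟨y, hy, hyn⟩ := h.isPreconnected.ordConnected.out (mem_image_of_mem _ hr)
      (mem_image_of_mem _ m') ⟨hrn.le, hn.le⟩
    have hyt : y < t' := (h.mono.lt_iff_lt hy m').1 (hyn.trans_lt hn)
    refine ⟨y, ⟨hlu ⟨hl.trans hy.1, hyt.trans (ht'.trans_le (min_le_left _ _))⟩, ?_⟩, hy.1.ne'⟩
    rw [h.arcSolutions_one]
    exact ⟨hy, n, hyn⟩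

theorem right_mem_derivedSet_iff (h : IsArgumentOn B α β φ) :
    β ∈ derivedSet (arcSolutions B α β 1) ↔ ¬BddAbove (φ '' Ioo α β) := by
  have hpi := Real.two_pi_pos
  obtain ⟨t, ht⟩ := nonempty_Ioo.2 h.lt
  constructor
  · intro hx hb
    refine (h.finite_inter (U := Ioi t) ⟨φ t, ?_⟩
      (hb.mono (image_mono inter_subset_left))).notMem_derivedSet (Ioi_mem_nhds ht.2) hx
    rintro _ ⟨s, ⟨hs, hs'⟩, rfl⟩
    exact (h.mono ht hs hs').le
  · intro hb
    rw [mem_derivedSet, accPt_iff_nhds]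
    intro U hU
    obtain ⟨l, u, ⟨hl, hu⟩, hlu⟩ := mem_nhds_iff_exists_Ioo_subset.1 hU
    obtain ⟨t', ht', ht'β⟩ := exists_between (max_lt hl h.lt)
    have m' : t' ∈ Ioo α β := ⟨(le_max_right _ _).trans_lt ht', ht'β⟩
    obtain ⟨n, hn⟩ := exists_int_gt (φ t' / (2 * Real.pi))
    rw [div_lt_iff₀ hpi] at hn
    rw [not_bddAbove_iff] at hb
    obtain ⟨_, ⟨r, hr, rfl⟩, hrn⟩ := hb (n * (2 * Real.pi))
    obtain ⟨y, hy, hyn⟩ := h.isPreconnected.ordConnected.out (mem_image_of_mem _ m')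
      (mem_image_of_mem _ hr) ⟨hn.le, hrn.le⟩
    have hyt : t' < y := (h.mono.lt_iff_lt m' hy).1 (hn.trans_eq hyn.symm)
    refine ⟨y, ⟨hlu ⟨((le_max_left _ _).trans_lt ht').trans hyt, hy.2.trans hu⟩, ?_⟩, hy.2.ne⟩
    rw [h.arcSolutions_one]
    exact ⟨hy, n, hyn⟩

theorem finite_iff (h : IsArgumentOn B α β φ) :
    (arcSolutions B α β 1).Finite ↔ BddBelow (φ '' Ioo α β) ∧ BddAbove (φ '' Ioo α β) := by
  constructor
  · intro hf
    have hd : ∀ x, x ∉ derivedSet (arcSolutions B α β 1) := fun x =>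
      (hf.inter_of_left univ).notMem_derivedSet univ_mem
    exact ⟨not_not.1 fun hb => hd α (h.left_mem_derivedSet_iff.2 hb),
      not_not.1 fun hb => hd β (h.right_mem_derivedSet_iff.2 hb)⟩
  · rintro ⟨h1, h2⟩
    simpa using h.finite_inter (U := univ) (by simpa using h1) (by simpa using h2)

theorem isType0_iff (h : IsArgumentOn B α β φ) :
    IsType0 B α β ↔ BddBelow (φ '' Ioo α β) ∧ BddAbove (φ '' Ioo α β) :=
  h.finite_iff

theorem isType1a_iff (h : IsArgumentOn B α β φ) :
    IsType1a B α β ↔ ¬BddBelow (φ '' Ioo α β) ∧ BddAbove (φ '' Ioo α β) := by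
  rw [IsType1a, Set.Infinite, h.finite_iff]
  have h1 := h.left_mem_derivedSet_iff
  have h2 := h.right_mem_derivedSet_iff
  constructor
  · rintro ⟨-, hd⟩
    rw [hd] at h1 h2
    exact ⟨h1.1 rfl, not_not.1 fun hb => h.lt.ne' (h2.2 hb)⟩
  · rintro ⟨hb, hb'⟩
    refine ⟨fun hc => hb hc.1, Subset.antisymm (fun x hx => ?_) (by simpa using h1.2 hb)⟩
    rcases h.derivedSet_subset hx with rfl | rfl
    · rfl
    · exact absurd hb' (h2.1 hx)

theorem isType1b_iff (h : IsArgumentOn B α β φ) :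
    IsType1b B α β ↔ BddBelow (φ '' Ioo α β) ∧ ¬BddAbove (φ '' Ioo α β) := by
  rw [IsType1b, Set.Infinite, h.finite_iff]
  have h1 := h.left_mem_derivedSet_iff
  have h2 := h.right_mem_derivedSet_iff
  constructor
  · rintro ⟨-, hd⟩
    rw [hd] at h1 h2
    exact ⟨not_not.1 fun hb => h.lt.ne (h1.2 hb), h2.1 rfl⟩
  · rintro ⟨hb, hb'⟩
    refine ⟨fun hc => hb' hc.2, Subset.antisymm (fun x hx => ?_) (by simpa using h2.2 hb')⟩
    rcases h.derivedSet_subset hx with rfl | rfl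
    · exact absurd hb (h1.1 hx)
    · rfl

theorem isType2_iff (h : IsArgumentOn B α β φ) : IsType2 B α β ↔ φ '' Ioo α β = univ := by
  rw [IsType2, Set.Infinite, h.finite_iff]
  have h1 := h.left_mem_derivedSet_iff
  have h2 := h.right_mem_derivedSet_iff
  constructor
  · rintro ⟨-, hd⟩
    rw [hd] at h1 h2
    exact h.isPreconnected.eq_univ_of_unbounded (h1.1 (Or.inl rfl)) (h2.1 (Or.inr rfl))
  · intro hu
    rw [hu] at h1 h2 ⊢
    have hb : ¬BddBelow (univ : Set ℝ) := not_bddBelow_univ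
    refine ⟨fun hc => hb hc.1, Subset.antisymm h.derivedSet_subset ?_⟩
    rintro x (rfl | rfl)
    · exact h1.2 hb
    · exact h2.2 not_bddAbove_univ

theorem tendsto_left (h : IsArgumentOn B α β φ) (hb : BddBelow (φ '' Ioo α β)) :
    Tendsto (fun t => boundaryValue B (Circle.exp t)) (𝓝[>] α)
      (𝓝 (Circle.exp (sInf (φ '' Ioo α β)) : ℂ)) := by
  have h1 := h.mono.monotoneOn.tendsto_nhdsWithin_Ioo_right (nonempty_Ioo.2 h.lt) hb
  have hc : Continuous fun s : ℝ => (Circle.exp s : ℂ) :=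
    continuous_subtype_val.comp Circle.exp.continuous
  refine ((hc.tendsto _).comp h1).congr' ?_
  filter_upwards [Ioo_mem_nhdsGT h.lt] with t ht using (h.eq t ht).symm

theorem tendsto_right (h : IsArgumentOn B α β φ) (hb : BddAbove (φ '' Ioo α β)) :
    Tendsto (fun t => boundaryValue B (Circle.exp t)) (𝓝[<] β)
      (𝓝 (Circle.exp (sSup (φ '' Ioo α β)) : ℂ)) := by
  have h1 := h.mono.monotoneOn.tendsto_nhdsWithin_Ioo_left (nonempty_Ioo.2 h.lt) hb
  have hc : Continuous fun s : ℝ => (Circle.exp s : ℂ) :=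
    continuous_subtype_val.comp Circle.exp.continuous
  refine ((hc.tendsto _).comp h1).congr' ?_
  filter_upwards [Ioo_mem_nhdsLT h.lt] with t ht using (h.eq t ht).symm

variable {α' β' : ℝ} {φ' : ℝ → ℝ}

theorem sameArcType_of_image_eq (h : IsArgumentOn B α β φ) (h' : IsArgumentOn B α' β' φ')
    (he : φ' '' Ioo α' β' = φ '' Ioo α β) : SameArcType B α β α' β' := by
  have hs : ∀ w, (arcSolutions B α β w).encard = (arcSolutions B α' β' w).encard := fun w => by
    by_cases hw : ‖w‖ = 1
    · obtain ⟨s, hs⟩ : ∃ s : ℝ, Circle.exp s = ⟨w, by simpa [Submonoid.unitSphere] using hw⟩ :=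
        ⟨_, Circle.exp_arg _⟩
      have hs' : w = Circle.exp s := by rw [hs]
      rw [hs', h.encard_arcSolutions, h'.encard_arcSolutions, he]
    · rw [h.arcSolutions_eq_empty hw, h'.arcSolutions_eq_empty hw]
  rw [SameArcType, h.isType0_iff, h'.isType0_iff, h.isType1a_iff, h'.isType1a_iff, h.isType1b_iff,
    h'.isType1b_iff, h.isType2_iff, h'.isType2_iff, he]
  by_cases h1 : BddBelow (φ '' Ioo α β) <;> by_cases h2 : BddAbove (φ '' Ioo α β)
  · exact Or.inl ⟨⟨h1, h2⟩, ⟨h1, h2⟩, hs⟩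
  · refine Or.inr (Or.inr (Or.inl ⟨⟨h1, h2⟩, ⟨h1, h2⟩, _, h.tendsto_left h1, ?_⟩))
    rw [← he]
    exact h'.tendsto_left (by rwa [he])
  · refine Or.inr (Or.inl ⟨⟨h1, h2⟩, ⟨h1, h2⟩, _, h.tendsto_right h2, ?_⟩)
    rw [← he]
    exact h'.tendsto_right (by rwa [he])
  · have := h.isPreconnected.eq_univ_of_unbounded h1 h2
    exact Or.inr (Or.inr (Or.inr ⟨this, this⟩))

/-- Two arcs are of exactly the same type if and only if their images under the arguments of `B`
are translates of each other by a multiple of `2π`. -/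
theorem sameArcType_iff (h : IsArgumentOn B α β φ) (h' : IsArgumentOn B α' β' φ') :
    SameArcType B α β α' β' ↔
      ∃ n : ℤ, φ' '' Ioo α' β' = (fun s => s + n * (2 * Real.pi)) '' (φ '' Ioo α β) := by
  have hpi := Real.two_pi_pos
  constructor
  · rintro (⟨h0, h0', hs⟩ | ⟨h0, h0', L, hL, hL'⟩ | ⟨h0, h0', L, hL, hL'⟩ | ⟨h0, h0'⟩)
    · rw [h.isType0_iff] at h0
      rw [h'.isType0_iff] at h0'
      have e := h.isPreconnected.eq_Ioo_csInf_csSup h.isOpen h0.1 h0.2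
      have e' := h'.isPreconnected.eq_Ioo_csInf_csSup h'.isOpen h0'.1 h0'.2
      have lt1 := nonempty_Ioo.1 (e ▸ h.nonempty)
      have lt2 := nonempty_Ioo.1 (e' ▸ h'.nonempty)
      have hs' := fun s : ℝ => hs (Circle.exp s)
      simp_rw [h.encard_arcSolutions, h'.encard_arcSolutions] at hs'
      set E := φ '' Ioo α β
      set E' := φ' '' Ioo α' β'
      -- Division by `2π` turns the cosets of `2πℤ` into cosets of `ℤ`.
      obtain ⟨m, hm1, hm2⟩ := exists_int_translate_of_encard_eq
        (u := sInf E / (2 * Real.pi)) (v := sSup E / (2 * Real.pi))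
        (u' := sInf E' / (2 * Real.pi)) (v' := sSup E' / (2 * Real.pi))
        (by gcongr) (by gcongr) (fun s => by
          have h1 := hs' (s * (2 * Real.pi))
          rw [e, e'] at h1
          simp only [mem_Ioo, ← add_mul, ← div_lt_iff₀ hpi, ← lt_div_iff₀ hpi] at h1
          exact h1)
      refine ⟨m, ?_⟩
      rw [e, e', image_add_const_Ioo]
      field_simp at hm1 hm2
      rw [hm1, hm2]
      congr 1 <;> ring
    · rw [h.isType1a_iff] at h0
      rw [h'.isType1a_iff] at h0'
      have e1 := tendsto_nhds_unique hL (h.tendsto_right h0.2)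
      have e2 := tendsto_nhds_unique hL' (h'.tendsto_right h0'.2)
      -- Equal one-sided limits mean that the suprema agree modulo `2π`; an open half-line unbounded
      -- below is determined by its supremum.
      rw [e1, Circle.coe_inj, eq_comm, Circle.exp_eq_exp] at e2
      obtain ⟨m, hm⟩ := e2
      refine ⟨m, ?_⟩
      rw [h'.isPreconnected.eq_Iio_csSup h'.isOpen h0'.1 h0'.2, hm,
        ← image_add_const_Iio, ← h.isPreconnected.eq_Iio_csSup h.isOpen h0.1 h0.2]
    · rw [h.isType1b_iff] at h0
      rw [h'.isType1b_iff] at h0'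
      have e1 := tendsto_nhds_unique hL (h.tendsto_left h0.1)
      have e2 := tendsto_nhds_unique hL' (h'.tendsto_left h0'.1)
      rw [e1, Circle.coe_inj, eq_comm, Circle.exp_eq_exp] at e2
      obtain ⟨m, hm⟩ := e2
      refine ⟨m, ?_⟩
      rw [h'.isPreconnected.eq_Ioi_csInf h'.isOpen h0'.1 h0'.2, hm,
        ← image_add_const_Ioi, ← h.isPreconnected.eq_Ioi_csInf h.isOpen h0.1 h0.2]
    · rw [h.isType2_iff] at h0
      rw [h'.isType2_iff] at h0'
      exact ⟨0, by simp [h0, h0']⟩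
  · rintro ⟨n, hn⟩
    -- `φ + 2πn` is again an argument of `B` on the first arc, and its image is that of `φ'`.
    have h1 := sameArcType_of_image_eq (h.add_int n) h' (by rw [hn, image_image])
    exact h1

end IsArgumentOn

/-! ### The cyclic order of singular angles and arcs -/

namespace IsCyclicListing

variable {B : ℂ → ℂ} {θ : ℤ → ℝ}

theorem add_mul_four (h : IsCyclicListing B 4 θ) (j m : ℤ) :
    θ (j + m * 4) = θ j + m * (2 * Real.pi) := by
  have h4 : ∀ j : ℤ, θ (j + 4) = θ j + 2 * Real.pi := fun j => by
    have := h.2.1 j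
    push_cast at this
    exact this
  induction m using Int.induction_on with
  | zero => simp
  | succ i ih =>
    rw [add_mul, ← add_assoc, one_mul, h4, ih]
    push_cast
    ring
  | pred i ih =>
    have := h4 (j + (-(i : ℤ) - 1) * 4)
    rw [show j + (-(i : ℤ) - 1) * 4 + 4 = j + -(i : ℤ) * 4 by ring, ih] at this
    push_cast at this ⊢
    linarith

theorem add_four (h : IsCyclicListing B 4 θ) (j : ℤ) : θ (j + 4) = θ j + 2 * Real.pi := by
  simpa using h.add_mul_four j 1

theorem lt_succ (h : IsCyclicListing B 4 θ) (j : ℤ) : θ j < θ (j + 1) :=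
  h.1 (lt_add_one j)

theorem exp_mem_singularSet (h : IsCyclicListing B 4 θ) {t : ℝ} :
    Circle.exp t ∈ singularSet B ↔ ∃ j, t = θ j := by
  rw [h.2.2]
  constructor
  · rintro ⟨j, hj⟩
    obtain ⟨m, hm⟩ := Circle.exp_eq_exp.1 hj.symm
    exact ⟨j + m * 4, by rw [hm, h.add_mul_four]⟩
  · rintro ⟨j, rfl⟩
    exact ⟨j, rfl⟩

theorem eq_of_mem_Ico (h : IsCyclicListing B 4 θ) {i j : ℤ} {t : ℝ}
    (hi : t ∈ Ico (θ i) (θ (i + 1))) (hj : t ∈ Ico (θ j) (θ (j + 1))) : i = j := by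
  have h1 := h.1.lt_iff_lt.1 (hi.1.trans_lt hj.2)
  have h2 := h.1.lt_iff_lt.1 (hj.1.trans_lt hi.2)
  omega

theorem exp_notMem_singularSet (h : IsCyclicListing B 4 θ) {j : ℤ} {t : ℝ}
    (ht : t ∈ Ioo (θ j) (θ (j + 1))) : Circle.exp t ∉ singularSet B := by
  rw [h.exp_mem_singularSet]
  rintro ⟨i, rfl⟩
  have h1 := h.1.lt_iff_lt.1 ht.1
  have h2 := h.1.lt_iff_lt.1 ht.2
  omega

theorem exists_mem_Ico (h : IsCyclicListing B 4 θ) (t : ℝ) :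
    ∃ j, t ∈ Ico (θ j) (θ (j + 1)) := by
  have hpi := Real.two_pi_pos
  obtain ⟨j, hj, hmax⟩ := Int.exists_greatest_of_bdd (P := fun j => θ j ≤ t) (by
      obtain ⟨m, hm⟩ := exists_int_gt ((t - θ 0) / (2 * Real.pi))
      rw [div_lt_iff₀ hpi] at hm
      refine ⟨m * 4, fun z hz => ?_⟩
      rw [← h.1.le_iff_le]
      have := h.add_mul_four 0 m
      rw [zero_add] at this
      linarith) (by
      obtain ⟨m, hm⟩ := exists_int_lt ((t - θ 0) / (2 * Real.pi))
      rw [lt_div_iff₀ hpi] at hm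
      refine ⟨0 + m * 4, ?_⟩
      rw [h.add_mul_four]
      linarith)
  refine ⟨j, hj, ?_⟩
  by_contra! hc
  have := hmax _ hc
  omega

theorem add_mem_Ioo_iff (h : IsCyclicListing B 4 θ) {j : ℤ} {t : ℝ} :
    t + 2 * Real.pi ∈ Ioo (θ (j + 4)) (θ (j + 4 + 1)) ↔ t ∈ Ioo (θ j) (θ (j + 1)) := by
  rw [show j + 4 + 1 = j + 1 + 4 by ring, h.add_four, h.add_four]
  simp

/-- A translation by `2πm` carries arc `j` onto arc `j + 4m`, which is disjoint from it unless `m =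
0`. -/
theorem eq_of_exp_eq (h : IsCyclicListing B 4 θ) {j : ℤ} {t u : ℝ}
    (ht : t ∈ Ioo (θ j) (θ (j + 1))) (hu : u ∈ Ioo (θ j) (θ (j + 1)))
    (he : Circle.exp t = Circle.exp u) : t = u := by
  obtain ⟨m, hm⟩ := Circle.exp_eq_exp.1 he
  have h1 : t ∈ Ico (θ (j + m * 4)) (θ (j + m * 4 + 1)) := by
    rw [show j + m * 4 + 1 = j + 1 + m * 4 by ring, h.add_mul_four, h.add_mul_four, hm]
    exact ⟨by linarith [hu.1], by linarith [hu.2]⟩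
  have h2 := h.eq_of_mem_Ico h1 (Ioo_subset_Ico_self ht)
  have h3 : m = 0 := by omega
  simpa [h3] using hm

end IsCyclicListing

/-- A coherent choice of arguments of `B` along its four arcs, invariant under the full turn, such
that arguments whose images are translates of each other by a multiple of `2π` have equal
images. -/
structure ArcSystem (B : ℂ → ℂ) (θ : ℤ → ℝ) where
  /-- The argument of `B` along the `j`-th arc. -/
  φ : ℤ → ℝ → ℝ
  arg : ∀ j, IsArgumentOn B (θ j) (θ (j + 1)) (φ j)
  periodic : ∀ j t, φ (j + 4) (t + 2 * Real.pi) = φ j t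
  normalized : ∀ (i j n : ℤ), φ i '' Ioo (θ i) (θ (i + 1)) =
    (fun s => s + n * (2 * Real.pi)) '' (φ j '' Ioo (θ j) (θ (j + 1))) →
      φ i '' Ioo (θ i) (θ (i + 1)) = φ j '' Ioo (θ j) (θ (j + 1))

theorem image_Ioo_add_four {B : ℂ → ℂ} {θ : ℤ → ℝ} (h : IsCyclicListing B 4 θ)
    {φ : ℤ → ℝ → ℝ} (hφ : ∀ j t, φ (j + 4) (t + 2 * Real.pi) = φ j t) (j : ℤ) :
    φ (j + 4) '' Ioo (θ (j + 4)) (θ (j + 4 + 1)) = φ j '' Ioo (θ j) (θ (j + 1)) := by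
  ext y
  constructor
  · rintro ⟨t, ht, rfl⟩
    have e : t - 2 * Real.pi + 2 * Real.pi = t := by ring
    exact ⟨t - 2 * Real.pi, h.add_mem_Ioo_iff.1 (by rwa [e]), by rw [← hφ, e]⟩
  · rintro ⟨t, ht, rfl⟩
    exact ⟨t + 2 * Real.pi, h.add_mem_Ioo_iff.2 ht, hφ _ _⟩

/-- Choose a representative in each class of sets modulo translation by `2πℤ`, and let `k S` be a
translation taking `S` to its representative. -/
theorem exists_translate_normalization :
    ∃ k : Set ℝ → ℤ, ∀ (S S' : Set ℝ) (n : ℤ), S = (fun s => s + n * (2 * Real.pi)) '' S' →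
      (fun s => s + k S * (2 * Real.pi)) '' S = (fun s => s + k S' * (2 * Real.pi)) '' S' := by
  let r : Setoid (Set ℝ) :=
    { r := fun S S' => ∃ n : ℤ, S' = (fun s => s + n * (2 * Real.pi)) '' S
      iseqv := ⟨fun S => ⟨0, by simp⟩, fun {S S'} ⟨n, hn⟩ => ⟨-n, by
        rw [hn, image_image]
        simp only [Int.cast_neg, neg_mul, add_neg_cancel_right, image_id']⟩,
        fun {S S' S''} ⟨n, hn⟩ ⟨m, hm⟩ => ⟨n + m, by
          rw [hm, hn, image_image]; push_cast; congr 1; ext s; ring⟩⟩ }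
  have hr : ∀ S : Set ℝ, ∃ n : ℤ, (Quotient.mk r S).out = (fun s => s + n * (2 * Real.pi)) '' S :=
    fun S => r.symm (Quotient.mk_out S)
  choose k hk using hr
  refine ⟨k, fun S S' n h => ?_⟩
  rw [← hk, ← hk]
  have : (Quotient.mk r S) = Quotient.mk r S' := Quotient.sound (r.symm ⟨n, h⟩)
  rw [this]

theorem ArcSystem.nonempty {B : ℂ → ℂ} {θ : ℤ → ℝ} (hB : IsBlaschkeProduct B)
    (h : IsCyclicListing B 4 θ) : Nonempty (ArcSystem B θ) := by
  have hne : (singularSet B).Nonempty := ⟨Circle.exp (θ 0), h.exp_mem_singularSet.2 ⟨0, rfl⟩⟩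
  have hex : ∀ j, ∃ φ, IsArgumentOn B (θ j) (θ (j + 1)) φ := fun j => by
    obtain ⟨φ, h1, h2, h3⟩ := exists_continuous_argument hB hne (h.lt_succ j)
      fun t ht => h.exp_notMem_singularSet ht
    exact ⟨φ, h.lt_succ j, h1, h2, h3⟩
  choose φ hφ using hex
  -- Only the arguments on arcs `0` to `3` are kept; the others are transported by full turns, which
  -- forces periodicity.
  set φ' : ℤ → ℝ → ℝ := fun j t => φ (j % 4) (t - (j / 4 : ℤ) * (2 * Real.pi)) with hφ'
  have hp : ∀ j t, φ' (j + 4) (t + 2 * Real.pi) = φ' j t := fun j t => by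
    have e1 : (j + 4) % 4 = j % 4 := by omega
    have e2 : (j + 4) / 4 = j / 4 + 1 := by omega
    simp only [hφ', e1, e2]
    push_cast
    congr 1
    ring
  have harg : ∀ j, IsArgumentOn B (θ j) (θ (j + 1)) (φ' j) := fun j => by
    have e : ∀ i : ℤ, θ i = θ (i - j / 4 * 4) + (j / 4 : ℤ) * (2 * Real.pi) := fun i => by
      rw [← h.add_mul_four, sub_add_cancel]
    have e1 : j - j / 4 * 4 = j % 4 := by omega
    have e2 : j + 1 - j / 4 * 4 = j % 4 + 1 := by omega
    have hmap : MapsTo (fun t => t - (j / 4 : ℤ) * (2 * Real.pi)) (Ioo (θ j) (θ (j + 1)))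
        (Ioo (θ (j % 4)) (θ (j % 4 + 1))) := by
      intro t ht
      rw [e j, e (j + 1), e1, e2] at ht
      exact ⟨by linarith [ht.1], by linarith [ht.2]⟩
    refine ⟨h.lt_succ j, (hφ (j % 4)).cont.comp (by fun_prop) hmap,
      fun s hs t ht hst => (hφ (j % 4)).mono (hmap hs) (hmap ht) (by simpa using hst),
      fun t ht => ?_⟩
    rw [← (hφ (j % 4)).eq _ (hmap ht)]
    congr 1
    exact Circle.exp_eq_exp.2 ⟨j / 4, by ring⟩
  obtain ⟨k, hk⟩ := exists_translate_normalization
  set E : ℤ → Set ℝ := fun j => φ' j '' Ioo (θ j) (θ (j + 1)) with hE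
  have hEp : ∀ j, E (j + 4) = E j := image_Ioo_add_four h hp
  have himg : ∀ j, (fun t => φ' j t + k (E j) * (2 * Real.pi)) '' Ioo (θ j) (θ (j + 1)) =
      (fun s => s + k (E j) * (2 * Real.pi)) '' E j := fun j => by
    rw [hE, image_image]
  -- The correction depends on `j` only through the image `E j`, which has period `4`, so
  -- periodicity survives.
  refine ⟨fun j t => φ' j t + k (E j) * (2 * Real.pi), fun j => (harg j).add_int _,
    fun j t => by rw [hp, hEp], fun i j n hij => ?_⟩
  rw [himg, himg] at hij ⊢
  refine hk _ _ (k (E j) + n - k (E i)) ?_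
  have := congrArg (image fun s => s - k (E i) * (2 * Real.pi)) hij
  simp only [image_image, add_sub_cancel_right, image_id'] at this
  refine this.trans ?_
  push_cast
  congr 1
  ext s
  ring

namespace ArcSystem

variable {B : ℂ → ℂ} {θ : ℤ → ℝ} (A : ArcSystem B θ)

/-- The image of the argument of `B` along the `j`-th arc. -/
def img (j : ℤ) : Set ℝ := A.φ j '' Ioo (θ j) (θ (j + 1))

theorem img_add_mul_four (h : IsCyclicListing B 4 θ) (j m : ℤ) :
    A.img (j + m * 4) = A.img j := by
  have h4 : ∀ j, A.img (j + 4) = A.img j := image_Ioo_add_four h A.periodic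
  induction m using Int.induction_on with
  | zero => simp
  | succ i ih => rw [add_mul, ← add_assoc, one_mul, h4, ih]
  | pred i ih =>
    rw [← h4, show j + (-(i : ℤ) - 1) * 4 + 4 = j + -(i : ℤ) * 4 by ring, ih]

theorem φ_add_mul_four (j m : ℤ) (t : ℝ) :
    A.φ (j + m * 4) (t + m * (2 * Real.pi)) = A.φ j t := by
  induction m using Int.induction_on with
  | zero => simp
  | succ i ih =>
    rw [← ih, ← A.periodic (j + i * 4)]
    push_cast
    congr 1 <;> ring
  | pred i ih =>
    rw [← ih, ← A.periodic]
    push_cast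
    congr 1 <;> ring_nf

theorem isType2_iff (j : ℤ) : IsType2 B (θ j) (θ (j + 1)) ↔ A.img j = univ :=
  (A.arg j).isType2_iff

theorem sameArcType_iff (i j : ℤ) :
    SameArcType B (θ i) (θ (i + 1)) (θ j) (θ (j + 1)) ↔ A.img j = A.img i := by
  rw [(A.arg i).sameArcType_iff (A.arg j)]
  exact ⟨fun ⟨n, hn⟩ => A.normalized j i n hn, fun h => ⟨0, by simpa [img] using h⟩⟩

/-- `A.Rel r f t u` says that the map of the line which moves every arc `r` places further, adding
`2π f i` to the argument of `B` on the arc `i` it arrives at, takes `t` to `u`. -/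
def Rel (r : ℤ) (f : ℤ → ℤ) (t u : ℝ) : Prop :=
  ∃ j, (t = θ j ∧ u = θ (j + r)) ∨
    (t ∈ Ioo (θ j) (θ (j + 1)) ∧ u ∈ Ioo (θ (j + r)) (θ (j + r + 1)) ∧
      A.φ (j + r) u = A.φ j t + f (j + r) * (2 * Real.pi))

/-- The arguments of `B` admit the shift by `r` arcs with translations by `2π f`. -/
def Adm (r : ℤ) (f : ℤ → ℤ) : Prop :=
  ∀ j, A.img (j + r) = (fun s => s + f (j + r) * (2 * Real.pi)) '' A.img j

variable {A} {r s : ℤ} {f g : ℤ → ℤ}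

/-- Working with a relation makes inversion a swap of the variables: uniqueness and surjectivity
then come from monotonicity and existence for the inverse data. -/
theorem Rel.inv {t u : ℝ} (h : A.Rel r f t u) : A.Rel (-r) (fun i => -f (i + r)) u t := by
  obtain ⟨j, ⟨rfl, rfl⟩ | ⟨h1, h2, h3⟩⟩ := h
  · exact ⟨j + r, Or.inl ⟨rfl, by simp⟩⟩
  · refine ⟨j + r, Or.inr ⟨h2, ?_⟩⟩
    have e : j + r + -r = j := by ring
    rw [e]
    refine ⟨h1, ?_⟩
    rw [h3]; push_cast; ring

theorem Adm.inv (h : A.Adm r f) : A.Adm (-r) (fun i => -f (i + r)) := fun j => by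
  have h1 := h (j + -r)
  simp only [neg_add_cancel_right] at h1 ⊢
  rw [h1, image_image]
  push_cast
  simp

/-- For points of different arcs the order is that of the arcs, which the shift preserves. Within
one arc it can be tested on the strictly increasing arguments. -/
theorem Rel.lt (h : IsCyclicListing B 4 θ) {t u t' u' : ℝ} (h1 : A.Rel r f t u)
    (h2 : A.Rel r f t' u') (htt : t < t') : u < u' := by
  have mem : ∀ {t u : ℝ} {j : ℤ}, (t = θ j ∧ u = θ (j + r)) ∨
      (t ∈ Ioo (θ j) (θ (j + 1)) ∧ u ∈ Ioo (θ (j + r)) (θ (j + r + 1)) ∧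
      A.φ (j + r) u = A.φ j t + f (j + r) * (2 * Real.pi)) →
      t ∈ Ico (θ j) (θ (j + 1)) ∧ u ∈ Ico (θ (j + r)) (θ (j + r + 1)) := by
    rintro t u j (⟨rfl, rfl⟩ | ⟨h1, h2, -⟩)
    · exact ⟨⟨le_rfl, h.lt_succ _⟩, ⟨le_rfl, h.lt_succ _⟩⟩
    · exact ⟨Ioo_subset_Ico_self h1, Ioo_subset_Ico_self h2⟩
  obtain ⟨j, hj⟩ := h1
  obtain ⟨j', hj'⟩ := h2
  have m1 := mem hj
  have m2 := mem hj'
  have hle : j < j' + 1 := h.1.lt_iff_lt.1 ((m1.1.1.trans_lt htt).trans m2.1.2)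
  rcases (Int.lt_add_one_iff.1 hle).lt_or_eq with hlt | rfl
  · exact m1.2.2.trans_le ((h.1.monotone (by omega)).trans m2.2.1)
  · rcases hj with ⟨rfl, rfl⟩ | ⟨a1, a2, a3⟩ <;> rcases hj' with ⟨rfl, rfl⟩ | ⟨b1, b2, b3⟩
    · exact absurd htt (lt_irrefl _)
    · exact b2.1
    · exact absurd htt a1.1.not_gt
    · rw [← (A.arg _).mono.lt_iff_lt a2 b2, a3, b3]
      have := (A.arg _).mono a1 b1 htt
      linarith

theorem Rel.eq (h : IsCyclicListing B 4 θ) {t u u' : ℝ} (h1 : A.Rel r f t u)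
    (h2 : A.Rel r f t u') : u = u' := by
  rcases lt_trichotomy u u' with hlt | rfl | hlt
  · exact absurd (h1.inv.lt h h2.inv hlt) (lt_irrefl _)
  · rfl
  · exact absurd (h2.inv.lt h h1.inv hlt) (lt_irrefl _)

theorem Adm.exists_rel (h : IsCyclicListing B 4 θ) (hA : A.Adm r f) (t : ℝ) :
    ∃ u, A.Rel r f t u := by
  obtain ⟨j, hj⟩ := h.exists_mem_Ico t
  rcases hj.1.eq_or_lt with rfl | hlt
  · exact ⟨_, j, Or.inl ⟨rfl, rfl⟩⟩
  · have hm : A.φ j t + f (j + r) * (2 * Real.pi) ∈ A.img (j + r) := by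
      rw [hA j]
      exact ⟨_, ⟨t, ⟨hlt, hj.2⟩, rfl⟩, rfl⟩
    obtain ⟨u, hu, hu'⟩ := hm
    exact ⟨u, j, Or.inr ⟨⟨hlt, hj.2⟩, hu, hu'⟩⟩

theorem Rel.add_mul_four (h : IsCyclicListing B 4 θ) {t u : ℝ} (m : ℤ) (h1 : A.Rel r f t u) :
    A.Rel (r + m * 4) (fun i => f (i - m * 4)) t (u + m * (2 * Real.pi)) := by
  obtain ⟨j, h1⟩ := h1
  refine ⟨j, ?_⟩
  have e1 : j + (r + m * 4) = j + r + m * 4 := by ring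
  have e2 : j + r + m * 4 + 1 = j + r + 1 + m * 4 := by ring
  rw [e1, e2, h.add_mul_four, h.add_mul_four, A.φ_add_mul_four]
  simpa using h1

theorem Rel.add_two_pi (h : IsCyclicListing B 4 θ) {t u : ℝ} (hf : ∀ i, f (i + 4) = f i)
    (h1 : A.Rel r f t u) : A.Rel r f (t + 2 * Real.pi) (u + 2 * Real.pi) := by
  obtain ⟨j, h1⟩ := h1
  refine ⟨j + 4, ?_⟩
  have e1 : j + 4 + r = j + r + 4 := by ring
  rw [e1, h.add_mem_Ioo_iff, h.add_mem_Ioo_iff, h.add_four, h.add_four, A.periodic, A.periodic, hf]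
  simpa using h1

/-- Indexing translations by the arc of arrival makes composition agree with multiplication in `ℤ ^
4 ⋊ ℤ_4`. -/
theorem Rel.comp (h : IsCyclicListing B 4 θ) {t u v : ℝ} (h1 : A.Rel s g t u)
    (h2 : A.Rel r f u v) : A.Rel (r + s) (fun i => f i + g (i - r)) t v := by
  obtain ⟨j, h1⟩ := h1
  obtain ⟨i, h2⟩ := h2
  have hi : i = j + s := by
    refine h.eq_of_mem_Ico (t := u) ?_ ?_
    · rcases h2 with ⟨rfl, -⟩ | ⟨h2, -⟩
      · exact ⟨le_rfl, h.lt_succ _⟩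
      · exact Ioo_subset_Ico_self h2
    · rcases h1 with ⟨-, rfl⟩ | ⟨-, h2, -⟩
      · exact ⟨le_rfl, h.lt_succ _⟩
      · exact Ioo_subset_Ico_self h2
  subst hi
  refine ⟨j, ?_⟩
  have e : j + (r + s) = j + s + r := by ring
  simp only [e, add_sub_cancel_right]
  rcases h1 with ⟨rfl, rfl⟩ | ⟨a1, a2, a3⟩ <;> rcases h2 with ⟨h0, rfl⟩ | ⟨b1, b2, b3⟩
  · exact Or.inl ⟨rfl, rfl⟩
  · exact absurd b1.1 (lt_irrefl _)
  · exact absurd (h0 ▸ a2.1) (lt_irrefl _)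
  · refine Or.inr ⟨a1, b2, ?_⟩
    rw [b3, a3]; push_cast; ring

end ArcSystem

/-! ### The colour group and auxiliary facts -/

/-- The subgroup of `ℤ ^ 4 ⋊ ℤ_4` of the elements whose rotation preserves the colouring `c` of
`ℤ_4`, and whose translation is supported on the points of colour `u`. -/
def colorGroup {α : Type*} (c : ZMod 4 → α) (u : α) : Subgroup (ShiftProduct 4) where
  carrier := {k | (∀ i, c (i + k.right.toAdd) = c i) ∧ ∀ i, c i ≠ u → k.left i = 1}
  one_mem' := ⟨fun i => by simp, fun _ _ => rfl⟩
  mul_mem' := by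
    rintro a b ⟨ha, ha'⟩ ⟨hb, hb'⟩
    refine ⟨fun i => ?_, fun i hi => ?_⟩
    · rw [SemidirectProduct.mul_right, toAdd_mul, ← add_assoc, hb, ha]
    · have h1 : b.left (i - a.right.toAdd) = 1 := hb' _ (by
        rw [← ha, sub_add_cancel]; exact hi)
      rw [SemidirectProduct.mul_left, Pi.mul_apply, ha' i hi, one_mul]
      exact h1
  inv_mem' := by
    rintro a ⟨ha, ha'⟩
    refine ⟨fun i => ?_, fun i hi => ?_⟩
    · rw [SemidirectProduct.inv_right, toAdd_inv, ← ha, neg_add_cancel_right]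
    · have h1 : a.left (i - (a.right⁻¹).toAdd) = 1 := ha' _ (by
        rw [toAdd_inv, sub_neg_eq_add, ha]; exact hi)
      rw [SemidirectProduct.inv_left]
      change (a.left (i - (a.right⁻¹).toAdd))⁻¹ = 1
      rw [h1, inv_one]

/-- The translation part of an element of `ℤ ^ 4 ⋊ ℤ_4`, as a periodic sequence of integers. -/
def ShiftProduct.coeff (k : ShiftProduct 4) (i : ℤ) : ℤ := (k.left (i : ZMod 4)).toAdd

theorem ShiftProduct.coeff_mul (k l : ShiftProduct 4) {r : ℤ}
    (hr : (r : ZMod 4) = k.right.toAdd) (i : ℤ) :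
    ShiftProduct.coeff (k * l) i = ShiftProduct.coeff k i + ShiftProduct.coeff l (i - r) := by
  simp only [coeff, SemidirectProduct.mul_left, Pi.mul_apply, toAdd_mul, Int.cast_sub, hr]
  rfl

theorem ShiftProduct.coeff_sub_mul_four (k : ShiftProduct 4) (i m : ℤ) :
    ShiftProduct.coeff k (i - m * 4) = ShiftProduct.coeff k i := by
  have h : ((4 : ℤ) : ZMod 4) = 0 := rfl
  rw [coeff, Int.cast_sub, Int.cast_mul, h, mul_zero, sub_zero, coeff]

theorem ZMod.exists_eq_add_mul_four {r s : ℤ} (h : (r : ZMod 4) = s) : ∃ m : ℤ, s = r + m * 4 := by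
  rw [ZMod.intCast_eq_intCast_iff_dvd_sub] at h
  obtain ⟨m, hm⟩ := h
  refine ⟨m, ?_⟩
  push_cast at hm
  linarith

theorem Circle.exp_isQuotientMap : IsQuotientMap Circle.exp :=
  Circle.isCoveringMap_exp.isLocalHomeomorph.isOpenMap.isQuotientMap Circle.exp.continuous
    fun z => ⟨_, Circle.exp_arg z⟩

/-- A nonempty set invariant under a nonzero translation is unbounded in both directions. This
forces trivial translations on arcs not of type `2`. -/
theorem IsPreconnected.eq_univ_of_image_add_eq {E : Set ℝ} (hE : IsPreconnected E)
    (hne : E.Nonempty) {a : ℝ} (ha : a ≠ 0) (h : (fun s => s + a) '' E = E) : E = univ := by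
  have key : ∀ {F : Set ℝ} {b : ℝ}, F.Nonempty → 0 < b → (fun s => s + b) '' F = F →
      ¬BddAbove F := by
    intro F b hF hb hFb hbd
    have h1 : ∀ x ∈ F, x ≤ sSup F - b := fun x hx => by
      have : x + b ∈ F := hFb ▸ mem_image_of_mem _ hx
      linarith [le_csSup hbd this]
    linarith [csSup_le hF h1]
  have key' : ∀ {F : Set ℝ} {b : ℝ}, F.Nonempty → b < 0 → (fun s => s + b) '' F = F →
      ¬BddBelow F := by
    intro F b hF hb hFb hbd
    have h1 : ∀ x ∈ F, sInf F - b ≤ x := fun x hx => by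
      have : x + b ∈ F := hFb ▸ mem_image_of_mem _ hx
      linarith [csInf_le hbd this]
    linarith [le_csInf hF h1]
  have h' : (fun s => s + -a) '' E = E := by
    conv_lhs => rw [← h, image_image]
    simp
  rcases ha.lt_or_gt with ha | ha
  · exact hE.eq_univ_of_unbounded (key' hne ha h) (key hne (neg_pos.2 ha) h')
  · exact hE.eq_univ_of_unbounded (key' hne (neg_lt_zero.2 ha) h') (key hne ha h)

/-! ### The invariants form the colour group -/

namespace ArcSystem

variable {B : ℂ → ℂ} {θ : ℤ → ℝ} (A : ArcSystem B θ)

/-- The images of the arguments along the four arcs, as a colouring of `ℤ_4`. -/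
def color (z : ZMod 4) : Set ℝ := A.img z.val

theorem color_intCast (h : IsCyclicListing B 4 θ) (j : ℤ) : A.color j = A.img j := by
  obtain ⟨m, hm⟩ := ZMod.exists_eq_add_mul_four (r := ((j : ZMod 4).val : ℤ)) (s := j) (by simp)
  rw [color]
  conv_rhs => rw [hm]
  rw [A.img_add_mul_four h]

/-- The self-map `x` of the circle acts on the arcs as `k` prescribes. -/
def Rep (k : ShiftProduct 4) (x : Circle → Circle) : Prop :=
  ∀ (r : ℤ) (t u : ℝ), (r : ZMod 4) = k.right.toAdd → A.Rel r (ShiftProduct.coeff k) t u →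
    x (Circle.exp t) = Circle.exp u

variable {A} {k l : ShiftProduct 4}

/-- Integers `r` in the same class modulo `4` give lifts that differ by full turns, invisible on the
circle. -/
theorem Rep.of_exists (h : IsCyclicListing B 4 θ) {x : Circle → Circle} {r : ℤ}
    (hr : (r : ZMod 4) = k.right.toAdd)
    (hx : ∀ t u, A.Rel r (ShiftProduct.coeff k) t u → x (Circle.exp t) = Circle.exp u) :
    A.Rep k x := by
  intro s t u hs hR
  obtain ⟨m, rfl⟩ := ZMod.exists_eq_add_mul_four (hr.trans hs.symm)
  have h1 := hR.add_mul_four h (-m)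
  simp only [ShiftProduct.coeff_sub_mul_four] at h1
  rw [show r + m * 4 + -m * 4 = r by ring] at h1
  rw [hx _ _ h1]
  exact Circle.exp_eq_exp.2 ⟨-m, rfl⟩

/-- Any translation preserves an image equal to `ℝ`; on the other arcs the membership in
`colorGroup` makes the translation trivial. -/
theorem adm_of_mem (h : IsCyclicListing B 4 θ) (hk : k ∈ colorGroup A.color univ) {r : ℤ}
    (hr : (r : ZMod 4) = k.right.toAdd) : A.Adm r (ShiftProduct.coeff k) := by
  intro j
  have h1 : A.img (j + r) = A.img j := by
    rw [← A.color_intCast h, ← A.color_intCast h, Int.cast_add, hr, hk.1]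
  rw [h1]
  by_cases hu : A.img j = univ
  · rw [hu, eq_comm, image_univ, (add_right_surjective _).range_eq]
  · have h2 : k.left ((j + r : ℤ) : ZMod 4) = 1 :=
      hk.2 _ (by rw [A.color_intCast h, h1]; exact hu)
    rw [ShiftProduct.coeff, h2]
    simp

theorem Rep.unique (h : IsCyclicListing B 4 θ) (hk : k ∈ colorGroup A.color univ)
    {x y : Circle → Circle} (hx : A.Rep k x) (hy : A.Rep k y) : x = y := by
  funext ξ
  obtain ⟨t, rfl⟩ : ∃ t, Circle.exp t = ξ := ⟨_, Circle.exp_arg ξ⟩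
  obtain ⟨r, hr⟩ := ZMod.intCast_surjective k.right.toAdd
  obtain ⟨u, hu⟩ := (adm_of_mem h hk hr).exists_rel h t
  rw [hx r t u hr hu, hy r t u hr hu]

theorem Rep.mul (h : IsCyclicListing B 4 θ) (hk : k ∈ colorGroup A.color univ)
    (hl : l ∈ colorGroup A.color univ) {x y : Circle → Circle} (hx : A.Rep k x) (hy : A.Rep l y) :
    A.Rep (k * l) (x ∘ y) := by
  obtain ⟨r, hr⟩ := ZMod.intCast_surjective k.right.toAdd
  obtain ⟨s, hs⟩ := ZMod.intCast_surjective l.right.toAdd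
  refine Rep.of_exists h (r := r + s) (by
    rw [Int.cast_add, hr, hs, SemidirectProduct.mul_right, toAdd_mul]) fun t v hv => ?_
  obtain ⟨u, hu⟩ := (adm_of_mem h hl hs).exists_rel h t
  obtain ⟨w, hw⟩ := (adm_of_mem h hk hr).exists_rel h u
  have h1 := hu.comp h hw
  have h2 : (fun i => ShiftProduct.coeff k i + ShiftProduct.coeff l (i - r)) =
      ShiftProduct.coeff (k * l) := funext fun i => (ShiftProduct.coeff_mul k l hr i).symm
  rw [h2] at h1
  rw [hv.eq h h1, Function.comp_apply, hy s t u hs hu, hx r u w hr hw]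

/-- The rotation can be read off from the image of one singularity, and each translation from the
image of one point of the arc concerned. -/
theorem Rep.injective (h : IsCyclicListing B 4 θ) (hk : k ∈ colorGroup A.color univ)
    (hl : l ∈ colorGroup A.color univ) {x : Circle → Circle} (hx : A.Rep k x) (hy : A.Rep l x) :
    k = l := by
  obtain ⟨r, hr⟩ := ZMod.intCast_surjective k.right.toAdd
  obtain ⟨s, hs⟩ := ZMod.intCast_surjective l.right.toAdd
  have hright : k.right.toAdd = l.right.toAdd := by
    have h1 := hx r (θ 0) (θ (0 + r)) hr ⟨0, Or.inl ⟨rfl, rfl⟩⟩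
    have h2 := hy s (θ 0) (θ (0 + s)) hs ⟨0, Or.inl ⟨rfl, rfl⟩⟩
    obtain ⟨m, hm⟩ := Circle.exp_eq_exp.1 (h1.symm.trans h2)
    rw [← h.add_mul_four] at hm
    have h3 : r = s + m * 4 := by
      have := h.1.injective hm
      linarith
    have h4 : ((4 : ℤ) : ZMod 4) = 0 := rfl
    rw [← hr, ← hs, h3, Int.cast_add, Int.cast_mul, h4, mul_zero, add_zero]
  refine SemidirectProduct.ext (funext fun z => ?_) hright
  obtain ⟨i, rfl⟩ := ZMod.intCast_surjective z
  have hr' := hr.trans hright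
  obtain ⟨t, ht⟩ := nonempty_Ioo.2 (h.lt_succ (i - r))
  have aux : ∀ {k' : ShiftProduct 4} (_ : A.Adm r (ShiftProduct.coeff k')),
      ∃ u ∈ Ioo (θ i) (θ (i + 1)), A.φ i u = A.φ (i - r) t +
        ShiftProduct.coeff k' i * (2 * Real.pi) ∧ A.Rel r (ShiftProduct.coeff k') t u := by
    intro k' hA
    have h1 := hA (i - r)
    have hm : A.φ (i - r) t + ShiftProduct.coeff k' (i - r + r) * (2 * Real.pi) ∈
        A.img (i - r + r) := by
      rw [h1]
      exact ⟨_, ⟨t, ht, rfl⟩, rfl⟩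
    obtain ⟨u, hu, hu'⟩ := hm
    have hR : A.Rel r (ShiftProduct.coeff k') t u := ⟨i - r, Or.inr ⟨ht, hu, hu'⟩⟩
    rw [sub_add_cancel] at hu hu'
    exact ⟨u, hu, hu', hR⟩
  obtain ⟨u, hu, hu', hR⟩ := aux (adm_of_mem h hk hr)
  obtain ⟨v, hv, hv', hR'⟩ := aux (adm_of_mem h hl hr')
  have huv : u = v := h.eq_of_exp_eq hu hv
    ((hx r t u hr hR).symm.trans (hy r t v hr' hR'))
  rw [← huv, hu'] at hv'
  have h5 : ShiftProduct.coeff k i = ShiftProduct.coeff l i := by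
    simpa [Real.pi_ne_zero] using hv'
  exact h5

/-- The relation defines an increasing bijection of the line commuting with the full turn.
Monotonicity and surjectivity give continuity, also at the singular angles, and the map descends to
the circle. -/
theorem exists_rep (h : IsCyclicListing B 4 θ) (hk : k ∈ colorGroup A.color univ) :
    ∃ x ∈ invariants B, A.Rep k x := by
  obtain ⟨r, hr⟩ := ZMod.intCast_surjective k.right.toAdd
  have hA := adm_of_mem h hk hr
  choose X hX using fun t => hA.exists_rel h t
  have hmono : StrictMono X := fun s t hst => (hX s).lt h (hX t) hst
  have hsurj : Function.Surjective X := fun u => by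
    obtain ⟨t, ht⟩ := hA.inv.exists_rel h u
    refine ⟨t, (hX t).eq h ?_⟩
    have h1 := ht.inv
    simpa using h1
  have hcont : Continuous X := hmono.monotone.continuous_of_surjective hsurj
  have hper : ∀ t, X (t + 2 * Real.pi) = X t + 2 * Real.pi := fun t =>
    (hX _).eq h ((hX t).add_two_pi h fun i => by
      have := ShiftProduct.coeff_sub_mul_four k (i + 4) 1
      simpa using this.symm)
  have hexp : ∀ t u : ℝ, Circle.exp t = Circle.exp u → Circle.exp (X t) = Circle.exp (X u) := by
    have hp : Function.Periodic (fun t => Circle.exp (X t)) (2 * Real.pi) := fun t => by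
      simp only [hper]
      exact Circle.periodic_exp _
    intro t u htu
    obtain ⟨m, rfl⟩ := Circle.exp_eq_exp.1 htu
    exact hp.int_mul m u
  set x : Circle → Circle := fun ξ => Circle.exp (X (ξ : ℂ).arg) with hx
  have hxX : ∀ t : ℝ, x (Circle.exp t) = Circle.exp (X t) := fun t =>
    hexp _ _ (Circle.exp_arg _)
  have hxR : ∀ t u, A.Rel r (ShiftProduct.coeff k) t u → x (Circle.exp t) = Circle.exp u :=
    fun t u hu => by rw [hxX, (hX t).eq h hu]
  refine ⟨x, ⟨?_, fun ξ => ?_, fun ξ hξ => ?_⟩, Rep.of_exists h hr hxR⟩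
  · rw [Circle.exp_isQuotientMap.continuous_iff]
    have : x ∘ Circle.exp = Circle.exp ∘ X := funext hxX
    rw [this]
    exact Circle.exp.continuous.comp hcont
  · obtain ⟨t, rfl⟩ : ∃ t, Circle.exp t = ξ := ⟨_, Circle.exp_arg ξ⟩
    rw [hxX]
    obtain ⟨j, ⟨h1, h2⟩ | ⟨h1, h2, -⟩⟩ := hX t
    · rw [h.exp_mem_singularSet, h.exp_mem_singularSet]
      exact iff_of_true ⟨_, h2⟩ ⟨_, h1⟩
    · exact iff_of_false (h.exp_notMem_singularSet h2) (h.exp_notMem_singularSet h1)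
  · obtain ⟨t, rfl⟩ : ∃ t, Circle.exp t = ξ := ⟨_, Circle.exp_arg ξ⟩
    rw [hxX]
    obtain ⟨j, ⟨h1, h2⟩ | ⟨h1, h2, h3⟩⟩ := hX t
    · exact absurd (h.exp_mem_singularSet.2 ⟨_, h1⟩) hξ
    · rw [(A.arg _).eq _ h1, (A.arg _).eq _ h2, h3, Circle.coe_inj]
      exact Circle.exp_eq_exp.2 ⟨_, rfl⟩

/-- Neither injectivity nor surjectivity of `x` is assumed: both follow from the monotone arguments
of `B` along the arcs and from the behaviour of the lift at the singular angles. -/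
theorem exists_rep_of_mem (h : IsCyclicListing B 4 θ) {x : Circle → Circle}
    (hx : x ∈ invariants B) : ∃ k ∈ colorGroup A.color univ, A.Rep k x := by
  have hpi := Real.two_pi_pos
  obtain ⟨hxc, hxs, hxB⟩ := hx
  obtain ⟨t₀, ht₀⟩ : ∃ t, Circle.exp t = x (Circle.exp 0) := ⟨_, Circle.exp_arg _⟩
  obtain ⟨X, ⟨-, hX⟩, -⟩ := Circle.isCoveringMap_exp.existsUnique_continuousMap_lifts
    (⟨fun t : ℝ => x (Circle.exp t), hxc.comp Circle.exp.continuous⟩ : C(ℝ, Circle)) 0 t₀ ht₀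
  replace hX : ∀ t, Circle.exp (X t) = x (Circle.exp t) := fun t => congrFun hX t
  have hXc : Continuous X := X.continuous
  have hsing : ∀ t, (∃ j, X t = θ j) ↔ ∃ j, t = θ j := fun t => by
    rw [← h.exp_mem_singularSet, ← h.exp_mem_singularSet, hX]
    exact hxs _
  -- The image of an arc is connected and avoids all singular angles.
  have harc : ∀ j, ∃ i, MapsTo X (Ioo (θ j) (θ (j + 1))) (Ioo (θ i) (θ (i + 1))) := fun j => by
    have hns : ∀ t ∈ Ioo (θ j) (θ (j + 1)), ∀ i, X t ≠ θ i := fun t ht i hi =>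
      h.exp_notMem_singularSet ht (h.exp_mem_singularSet.2 ((hsing t).1 ⟨i, hi⟩))
    obtain ⟨t, ht⟩ := nonempty_Ioo.2 (h.lt_succ j)
    obtain ⟨i, hi⟩ := h.exists_mem_Ico (X t)
    have hpc : (X '' Ioo (θ j) (θ (j + 1))).OrdConnected :=
      (isPreconnected_Ioo.image X hXc.continuousOn).ordConnected
    refine ⟨i, fun s hs => ⟨?_, ?_⟩⟩
    · by_contra! hc
      obtain ⟨v, hv, hv'⟩ := hpc.out (mem_image_of_mem _ hs) (mem_image_of_mem _ ht) ⟨hc, hi.1⟩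
      exact hns v hv i hv'
    · by_contra! hc
      obtain ⟨v, hv, hv'⟩ := hpc.out (mem_image_of_mem _ ht) (mem_image_of_mem _ hs) ⟨hi.2.le, hc⟩
      exact hns v hv (i + 1) hv'
  choose σ hσ using harc
  have hn : ∀ j, ∃ n : ℤ, ∀ t ∈ Ioo (θ j) (θ (j + 1)),
      A.φ (σ j) (X t) = A.φ j t + n * (2 * Real.pi) := fun j => by
    have hint : ∀ t ∈ Ioo (θ j) (θ (j + 1)), ∃ n : ℤ,
        A.φ (σ j) (X t) = A.φ j t + n * (2 * Real.pi) := fun t ht => by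
      rw [← Circle.exp_eq_exp, ← Circle.coe_inj, ← (A.arg _).eq _ (hσ j ht), ← (A.arg _).eq _ ht,
        hX]
      exact hxB _ (h.exp_notMem_singularSet ht)
    -- The difference is continuous with values in the countable set `2πℤ`, hence constant.
    have hsub : ((fun t => A.φ (σ j) (X t) - A.φ j t) '' Ioo (θ j) (θ (j + 1))).Subsingleton := by
      refine Set.Countable.isTotallyDisconnected
        (countable_range fun n : ℤ => (n : ℝ) * (2 * Real.pi)) _ ?_ ?_
      · rintro _ ⟨t, ht, rfl⟩
        obtain ⟨n, hn⟩ := hint t ht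
        exact ⟨n, by simp only [hn]; ring⟩
      · exact isPreconnected_Ioo.image _
          (((A.arg _).cont.comp hXc.continuousOn (hσ j)).sub (A.arg j).cont)
    obtain ⟨s, hs⟩ := nonempty_Ioo.2 (h.lt_succ j)
    obtain ⟨n, hn⟩ := hint s hs
    refine ⟨n, fun t ht => ?_⟩
    have := hsub (mem_image_of_mem _ ht) (mem_image_of_mem _ hs)
    linarith
  choose n hn using hn
  have hmono : ∀ j, StrictMonoOn X (Ioo (θ j) (θ (j + 1))) := fun j s hs t ht hst => by
    rw [← (A.arg _).mono.lt_iff_lt (hσ j hs) (hσ j ht), hn j s hs, hn j t ht]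
    have := (A.arg j).mono hs ht hst
    linarith
  -- By continuity and monotonicity `X (θ j)` lies in `[θ (σ j), θ (σ j + 1))`, and it is a singular
  -- angle.
  have hleft : ∀ j, X (θ j) = θ (σ j) := fun j => by
    obtain ⟨t, ht⟩ := nonempty_Ioo.2 (h.lt_succ j)
    have hc : Tendsto X (𝓝[>] (θ j)) (𝓝 (X (θ j))) := (hXc.tendsto _).mono_left nhdsWithin_le_nhds
    have h1 : X (θ j) ≤ X t := le_of_tendsto hc (by
      filter_upwards [Ioo_mem_nhdsGT ht.1] with s hs
      exact (hmono j ⟨hs.1, hs.2.trans ht.2⟩ ht hs.2).le)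
    have h2 : θ (σ j) ≤ X (θ j) := ge_of_tendsto hc (by
      filter_upwards [Ioo_mem_nhdsGT (h.lt_succ j)] with s hs using (hσ j hs).1.le)
    obtain ⟨i, hi⟩ := (hsing (θ j)).2 ⟨j, rfl⟩
    have h3 : X (θ j) < θ (σ j + 1) := h1.trans_lt (hσ j ht).2
    rw [hi, h.1.lt_iff_lt] at h3
    rw [hi, h.1.le_iff_le] at h2
    rw [hi, show i = σ j by omega]
  have hright : ∀ j, X (θ (j + 1)) = θ (σ j + 1) := fun j => by
    obtain ⟨t, ht⟩ := nonempty_Ioo.2 (h.lt_succ j)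
    have hc : Tendsto X (𝓝[<] (θ (j + 1))) (𝓝 (X (θ (j + 1)))) :=
      (hXc.tendsto _).mono_left nhdsWithin_le_nhds
    have h1 : X t ≤ X (θ (j + 1)) := ge_of_tendsto hc (by
      filter_upwards [Ioo_mem_nhdsLT ht.2] with s hs
      exact (hmono j ht ⟨ht.1.trans hs.1, hs.2⟩ hs.1).le)
    have h2 : X (θ (j + 1)) ≤ θ (σ j + 1) := le_of_tendsto hc (by
      filter_upwards [Ioo_mem_nhdsLT (h.lt_succ j)] with s hs using (hσ j hs).2.le)
    obtain ⟨i, hi⟩ := (hsing (θ (j + 1))).2 ⟨j + 1, rfl⟩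
    have h3 : θ (σ j) < X (θ (j + 1)) := (hσ j ht).1.trans_le h1
    rw [hi, h.1.lt_iff_lt] at h3
    rw [hi, h.1.le_iff_le] at h2
    rw [hi, show i = σ j + 1 by omega]
  -- The final point of arc `j` is the initial point of arc `j + 1`, so `X (θ (j + 1))` is computed
  -- in two ways.
  have hsucc : ∀ j, σ (j + 1) = σ j + 1 := fun j =>
    h.1.injective ((hleft (j + 1)).symm.trans (hright j))
  set r := σ 0
  have hσr : ∀ j, σ j = j + r := fun j => by
    induction j using Int.induction_on with
    | zero => simp [r]
    | succ i ih => rw [hsucc, ih]; ring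
    | pred i ih =>
      have := hsucc (-i - 1)
      rw [sub_add_cancel, ih] at this
      linarith
  simp only [hσr] at hσ hn hleft
  have himg : ∀ j, A.img (j + r) = (fun s => s + n j * (2 * Real.pi)) '' A.img j := fun j => by
    have hX' : X '' Ioo (θ j) (θ (j + 1)) = Ioo (θ (j + r)) (θ (j + r + 1)) := by
      refine Subset.antisymm (hσ j).image_subset ?_
      have h1 := intermediate_value_Ioo (h.lt_succ j).le hXc.continuousOn
      rwa [hleft, hright, hσr] at h1
    rw [img, ← hX', image_image, img, image_image]
    exact image_congr fun t ht => hn j t ht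
  have himg' : ∀ j, A.img (j + r) = A.img j := fun j => A.normalized _ _ _ (himg j)
  have hn0 : ∀ j, A.img j ≠ univ → n j = 0 := fun j hj => by
    by_contra hne
    have h1 := himg j
    rw [himg'] at h1
    refine hj (IsPreconnected.eq_univ_of_image_add_eq (A.arg j).isPreconnected (A.arg j).nonempty
      (a := n j * (2 * Real.pi)) ?_ h1.symm)
    exact mul_ne_zero (by exact_mod_cast hne) hpi.ne'
  -- The point `X (t + 2π) - 2π` lies in the same arc as `X t` and has the same exponential, so the
  -- two coincide.
  have hn4 : ∀ j, n (j + 4) = n j := fun j => by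
    obtain ⟨t, ht⟩ := nonempty_Ioo.2 (h.lt_succ j)
    have ht' := h.add_mem_Ioo_iff.2 ht
    have h1 := hσ (j + 4) ht'
    have e : j + 4 + r = j + r + 4 := by ring
    have e2 : X (t + 2 * Real.pi) = X (t + 2 * Real.pi) - 2 * Real.pi + 2 * Real.pi := by ring
    rw [e, e2, h.add_mem_Ioo_iff] at h1
    have h2 : X (t + 2 * Real.pi) - 2 * Real.pi = X t := by
      refine h.eq_of_exp_eq h1 (hσ j ht) ?_
      rw [Circle.periodic_exp.sub_eq, hX, hX, Circle.periodic_exp]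
    have h3 := hn (j + 4) _ ht'
    rw [e, e2, A.periodic, A.periodic, h2, hn j t ht] at h3
    have h4 : n j = n (j + 4) := by simpa [Real.pi_ne_zero] using h3
    exact h4.symm
  have hn4' : ∀ j m : ℤ, n (j + m * 4) = n j := fun j m => by
    have hp : Function.Periodic n 4 := hn4
    exact hp.int_mul m j
  -- `n` is indexed by the arc of departure, the coefficients by the arc of arrival; hence the shift
  -- by `r`.
  set k : ShiftProduct 4 :=
    ⟨fun z => Multiplicative.ofAdd (n (z.val - r)), Multiplicative.ofAdd (r : ZMod 4)⟩ with hk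
  have hcoeff : ∀ i, ShiftProduct.coeff k i = n (i - r) := fun i => by
    obtain ⟨m, hm⟩ := ZMod.exists_eq_add_mul_four (r := ((i : ZMod 4).val : ℤ)) (s := i) (by simp)
    have e : i - r = ((i : ZMod 4).val : ℤ) - r + m * 4 := by linarith
    rw [e, hn4']
    rfl
  have hkr : (r : ZMod 4) = k.right.toAdd := rfl
  refine ⟨k, ⟨fun z => ?_, fun z hz => ?_⟩, Rep.of_exists h hkr fun t u hR => ?_⟩
  · obtain ⟨i, rfl⟩ := ZMod.intCast_surjective z
    rw [← hkr, ← Int.cast_add, A.color_intCast h, A.color_intCast h, himg']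
  · obtain ⟨i, rfl⟩ := ZMod.intCast_surjective z
    rw [A.color_intCast h] at hz
    have h1 : ShiftProduct.coeff k i = 0 := by
      rw [hcoeff]
      refine hn0 _ ?_
      rwa [← himg', sub_add_cancel]
    exact h1
  · rw [← hX]
    congr 1
    obtain ⟨j, ⟨rfl, rfl⟩ | ⟨h1, h2, h3⟩⟩ := hR
    · exact hleft j
    · refine (A.arg (j + r)).mono.injOn (hσ j h1) h2 ?_
      rw [hn j t h1, h3, hcoeff, add_sub_cancel_right]

theorem nonempty_mulEquiv (A : ArcSystem B θ) (h : IsCyclicListing B 4 θ) :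
    Nonempty (invariants B ≃* colorGroup A.color univ) := by
  choose F hF hF' using fun k : colorGroup A.color univ => exists_rep (A := A) h k.2
  refine ⟨(MulEquiv.ofBijective (M := colorGroup A.color univ) (N := invariants B)
    (MulHom.mk (fun k => ⟨F k, hF k⟩) fun k l => ?_) ⟨fun k l hkl => ?_, fun x => ?_⟩).symm⟩
  · exact Subtype.ext (Rep.unique h (k * l).2 (hF' (k * l)) ((hF' k).mul h k.2 l.2 (hF' l)))
  · have h1 : F k = F l := congrArg Subtype.val hkl
    exact Subtype.ext (Rep.injective h k.2 l.2 (hF' k) (h1 ▸ hF' l))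
  · obtain ⟨k, hk, hR⟩ := exists_rep_of_mem (A := A) h x.2
    exact ⟨⟨k, hk⟩, Subtype.ext (Rep.unique h hk (hF' ⟨k, hk⟩) hR)⟩

end ArcSystem

/-! ### Classification of the colour groups -/

section ColorGroup

variable {α : Type*} {c : ZMod 4 → α} {u : α}

/-- The doubling embedding of `ℤ_2` into `ℤ_4`. -/
def zmodTwoToFour : ZMod 2 →+ ZMod 4 where
  toFun := fun s => 2 * (s.val : ZMod 4)
  map_zero' := rfl
  map_add' := by decide

theorem zmodTwoToFour_injective : Function.Injective zmodTwoToFour := by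
  unfold Function.Injective; decide

theorem mem_range_zmodTwoToFour {ρ : ZMod 4} : ρ ∈ range zmodTwoToFour ↔ ρ = 0 ∨ ρ = 2 := by
  revert ρ
  simp only [mem_range]
  decide

/-- Without nontrivial rotations, an element is just its translation part on the points of colour
`u`. -/
theorem colorGroup.nonempty_mulEquiv_freeAb (hR : ∀ ρ, (∀ i, c (i + ρ) = c i) → ρ = 0) :
    Nonempty (colorGroup c u ≃* FreeAb {i | c i = u}.ncard) := by
  classical
  have h0 : ∀ k : colorGroup c u, k.1.right = 1 := fun k => hR _ k.2.1
  let e : colorGroup c u ≃* ({i // c i = u} → Multiplicative ℤ) :=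
    { toFun := fun k i => k.1.left i
      invFun := fun f => ⟨⟨fun i => if h : c i = u then f ⟨i, h⟩ else 1, 1⟩,
        fun i => by simp, fun i hi => by simp [hi]⟩
      left_inv := fun k => by
        refine Subtype.ext (SemidirectProduct.ext (funext fun i => ?_) (h0 k).symm)
        by_cases hi : c i = u
        · simp [hi]
        · simp [hi, k.2.2 i hi]
      right_inv := fun f => by
        funext i
        simp [i.2]
      map_mul' := fun k l => by
        funext i
        simp [SemidirectProduct.mul_left, h0 k] }
  have hcard : Nat.card {i // c i = u} = {i | c i = u}.ncard := rfl
  exact ⟨e.trans (MulEquiv.arrowCongr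
    (Finite.equivFinOfCardEq hcard) (MulEquiv.refl _))⟩

theorem colorGroup.nonempty_mulEquiv_zmod_four (hR : ∀ i, c (i + 1) = c i) (hT : ∀ i, c i ≠ u) :
    Nonempty (colorGroup c u ≃* Multiplicative (ZMod 4)) := by
  have hR' : ∀ (ρ : ZMod 4) i, c (i + ρ) = c i := fun ρ i => by
    obtain ⟨n, rfl⟩ := ZMod.natCast_zmod_surjective ρ
    induction n with
    | zero => simp
    | succ n ih => rw [Nat.cast_succ, ← add_assoc, hR, ih]
  refine ⟨MulEquiv.ofBijective (SemidirectProduct.rightHom.comp (colorGroup c u).subtype)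
    ⟨fun k l hkl => ?_, fun ρ => ⟨⟨⟨1, ρ⟩, fun i => hR' _ i, fun _ _ => rfl⟩, rfl⟩⟩⟩
  refine Subtype.ext (SemidirectProduct.ext (funext fun i => ?_) hkl)
  rw [k.2.2 i (hT i), l.2.2 i (hT i)]

theorem colorGroup.nonempty_mulEquiv_shiftProduct_four (hT : ∀ i, c i = u) :
    Nonempty (colorGroup c u ≃* ShiftProduct 4) := by
  have h : colorGroup c u = ⊤ := by
    rw [Subgroup.eq_top_iff']
    exact fun k => ⟨fun i => by rw [hT, hT], fun i hi => absurd (hT i) hi⟩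
  rw [h]
  exact ⟨Subgroup.topEquiv⟩

theorem colorGroup.nonempty_mulEquiv_zmod_two (hR : ∀ ρ, (∀ i, c (i + ρ) = c i) ↔ ρ = 0 ∨ ρ = 2)
    (hT : ∀ i, c i ≠ u) : Nonempty (colorGroup c u ≃* Multiplicative (ZMod 2)) := by
  let f : Multiplicative (ZMod 2) →* ShiftProduct 4 :=
    SemidirectProduct.inr.comp (AddMonoidHom.toMultiplicative zmodTwoToFour)
  have hf : ∀ s, f s ∈ colorGroup c u := fun s =>
    ⟨(hR _).2 (mem_range_zmodTwoToFour.1 ⟨s.toAdd, rfl⟩), fun _ _ => rfl⟩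
  refine ⟨(MulEquiv.ofBijective (f.codRestrict (colorGroup c u) hf)
    ⟨fun s t hst => ?_, fun k => ?_⟩).symm⟩
  · have h1 : (f s).right = (f t).right := congrArg (fun k => k.1.right) hst
    exact zmodTwoToFour_injective h1
  · obtain ⟨s, hs⟩ := mem_range_zmodTwoToFour.2 ((hR _).1 k.2.1)
    refine ⟨Multiplicative.ofAdd s, Subtype.ext (SemidirectProduct.ext (funext fun i => ?_) hs)⟩
    rw [k.2.2 i (hT i)]
    rfl

theorem colorGroup.nonempty_mulEquiv_shiftProduct_two
    (hR : ∀ ρ, (∀ i, c (i + ρ) = c i) ↔ ρ = 0 ∨ ρ = 2) {p : ZMod 4}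
    (hT : ∀ i, c i = u ↔ i = p ∨ i = p + 2) :
    Nonempty (colorGroup c u ≃* ShiftProduct 2) := by
  -- `ε` enumerates the two points of colour `u` so that the rotation by `2` becomes the shift by
  -- `1` on `ZMod 2`; functions on `ZMod 2` are then extended by `1` to the other points.
  set ε : ZMod 2 → ZMod 4 := fun q => p + zmodTwoToFour q with hε
  have hinj : Function.Injective ε := fun q q' h => zmodTwoToFour_injective (add_left_cancel h)
  have hTε : ∀ i, c i = u ↔ ∃ q, ε q = i := fun i => by
    have h1 : (∃ q, ε q = i) ↔ i - p ∈ range zmodTwoToFour :=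
      exists_congr fun q => by rw [hε, eq_sub_iff_add_eq']
    rw [hT, h1, mem_range_zmodTwoToFour, sub_eq_zero, sub_eq_iff_eq_add']
  let ext : (ZMod 2 → Multiplicative ℤ) → ZMod 4 → Multiplicative ℤ := fun g =>
    Function.extend ε g 1
  have hext : ∀ g q, ext g (ε q) = g q := fun g q => hinj.extend_apply g _ q
  have hext' : ∀ g i, c i ≠ u → ext g i = 1 := fun g i hi =>
    Function.extend_apply' g _ i fun h => hi ((hTε i).2 h)
  have hshift : ∀ (s : ZMod 2) i, c (i - zmodTwoToFour s) = c i := fun s i => by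
    rw [← (hR _).2 (mem_range_zmodTwoToFour.1 ⟨s, rfl⟩) (i - zmodTwoToFour s), sub_add_cancel]
  let f : ShiftProduct 2 →* ShiftProduct 4 := MonoidHom.mk'
    (fun k => ⟨ext k.left, Multiplicative.ofAdd (zmodTwoToFour k.right.toAdd)⟩) fun k l => by
      refine SemidirectProduct.ext (funext fun i => ?_) ?_
      · change ext (k * l).left i =
          ext k.left i * ext l.left (i - zmodTwoToFour k.right.toAdd)
        by_cases hi : c i = u
        · obtain ⟨q, rfl⟩ := (hTε i).1 hi
          have e : ε q - zmodTwoToFour k.right.toAdd = ε (q - k.right.toAdd) := by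
            simp only [hε, map_sub, add_sub_assoc]
          rw [e, hext, hext, hext]
          rfl
        · rw [hext' _ _ hi, hext' _ _ hi, hext' _ _ (by rwa [hshift]), one_mul]
      · exact congrArg Multiplicative.ofAdd (map_add zmodTwoToFour k.right.toAdd l.right.toAdd)
  have hf : ∀ k, f k ∈ colorGroup c u := fun k =>
    ⟨(hR _).2 (mem_range_zmodTwoToFour.1 ⟨_, rfl⟩), fun i hi => hext' _ _ hi⟩
  refine ⟨(MulEquiv.ofBijective (f.codRestrict (colorGroup c u) hf)
    ⟨fun k l hkl => ?_, fun k => ?_⟩).symm⟩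
  · have h1 : f k = f l := congrArg Subtype.val hkl
    refine SemidirectProduct.ext (funext fun q => ?_) ?_
    · rw [← hext k.left, ← hext l.left]
      exact congrFun (congrArg SemidirectProduct.left h1) (ε q)
    · exact zmodTwoToFour_injective (congrArg SemidirectProduct.right h1)
  · obtain ⟨s, hs⟩ := mem_range_zmodTwoToFour.2 ((hR _).1 k.2.1)
    refine ⟨⟨fun q => k.1.left (ε q), Multiplicative.ofAdd s⟩,
      Subtype.ext (SemidirectProduct.ext (funext fun i => ?_) hs)⟩
    change ext _ i = k.1.left i
    by_cases hi : c i = u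
    · obtain ⟨q, rfl⟩ := (hTε i).1 hi
      rw [hext]
    · rw [hext' _ _ hi, k.2.2 i hi]

theorem colorGroup.classification (c : ZMod 4 → α) (u : α) :
    ({ρ | ∀ i, c (i + ρ) = c i}.ncard = 1 ∧ {i | c i = u}.ncard < 4 ∧
      Nonempty (colorGroup c u ≃* FreeAb {i | c i = u}.ncard)) ∨
    ({ρ | ∀ i, c (i + ρ) = c i}.ncard = 2 ∧ {i | c i = u}.ncard = 0 ∧
      Nonempty (colorGroup c u ≃* Multiplicative (ZMod 2))) ∨
    ({ρ | ∀ i, c (i + ρ) = c i}.ncard = 2 ∧ {i | c i = u}.ncard = 2 ∧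
      Nonempty (colorGroup c u ≃* ShiftProduct 2)) ∨
    ({ρ | ∀ i, c (i + ρ) = c i}.ncard = 4 ∧ {i | c i = u}.ncard = 0 ∧
      Nonempty (colorGroup c u ≃* Multiplicative (ZMod 4))) ∨
    ({ρ | ∀ i, c (i + ρ) = c i}.ncard = 4 ∧ {i | c i = u}.ncard = 4 ∧
      Nonempty (colorGroup c u ≃* ShiftProduct 4)) := by
  have huniv : (univ : Set (ZMod 4)).ncard = 4 := by
    rw [ncard_univ, Nat.card_zmod]
  have h3 : ∀ i : ZMod 4, i + 1 + 3 = i := by decide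
  have cases4 : ∀ i : ZMod 4, i = 0 ∨ i = 1 ∨ i = 2 ∨ i = 3 := by decide
  by_cases hR1 : ∀ i, c (i + 1) = c i
  · have hR : {ρ | ∀ i, c (i + ρ) = c i} = univ := by
      refine eq_univ_of_forall fun ρ i => ?_
      obtain ⟨n, rfl⟩ := ZMod.natCast_zmod_surjective ρ
      induction n with
      | zero => simp
      | succ n ih => rw [Nat.cast_succ, ← add_assoc, hR1, ih]
    have hc : ∀ i, c i = c 0 := fun i => by
      have h1 : i ∈ {ρ | ∀ i, c (i + ρ) = c i} := hR ▸ mem_univ i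
      simpa using h1 0
    rw [hR, huniv]
    by_cases hu : c 0 = u
    · have hT : ∀ i, c i = u := fun i => (hc i).trans hu
      refine Or.inr (Or.inr (Or.inr (Or.inr ⟨rfl, ?_,
        colorGroup.nonempty_mulEquiv_shiftProduct_four hT⟩)))
      rw [eq_univ_of_forall (s := {i | c i = u}) hT, huniv]
    · have hT : ∀ i, c i ≠ u := fun i => by rwa [hc i]
      refine Or.inr (Or.inr (Or.inr (Or.inl ⟨rfl, ?_,
        colorGroup.nonempty_mulEquiv_zmod_four hR1 hT⟩)))
      rw [eq_empty_of_forall_notMem (s := {i | c i = u}) hT, ncard_empty]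
  -- Invariance under `3 = -1` is invariance under `1`.
  have hR3 : ¬∀ i, c (i + 3) = c i := fun h => hR1 fun i => by rw [← h (i + 1), h3]
  by_cases hR2 : ∀ i, c (i + 2) = c i
  · have hR : ∀ ρ, (∀ i, c (i + ρ) = c i) ↔ ρ = 0 ∨ ρ = 2 := fun ρ => by
      constructor
      · intro h
        rcases cases4 ρ with rfl | rfl | rfl | rfl
        · exact Or.inl rfl
        · exact absurd h hR1
        · exact Or.inr rfl
        · exact absurd h hR3
      · rintro (rfl | rfl)
        · simp
        · exact hR2
    have hRc : {ρ | ∀ i, c (i + ρ) = c i}.ncard = 2 := by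
      have : {ρ | ∀ i, c (i + ρ) = c i} = {0, 2} := by
        ext ρ
        exact hR ρ
      rw [this, ncard_pair (by decide)]
    rw [hRc]
    by_cases hT : ∃ p, c p = u
    · obtain ⟨p, hp⟩ := hT
      -- If `p` and `p + 1` both had colour `u`, the period `2` would make the colouring constant.
      have hp1 : c (p + 1) ≠ u := fun h1 => hR1 fun i => by
        have e : ∀ p i : ZMod 4, i = p ∨ i = p + 1 ∨ i = p + 2 ∨ i = p + 1 + 2 := by decide
        have hall : ∀ i, c i = u := fun i => by
          rcases e p i with rfl | rfl | rfl | rfl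
          · exact hp
          · exact h1
          · rw [hR2, hp]
          · rw [hR2, h1]
        rw [hall, hall]
      have hT' : ∀ i, c i = u ↔ i = p ∨ i = p + 2 := fun i => by
        have e : ∀ p i : ZMod 4, i = p ∨ i = p + 1 ∨ i = p + 2 ∨ i = p + 1 + 2 := by decide
        constructor
        · intro hi
          rcases e p i with rfl | rfl | rfl | rfl
          · exact Or.inl rfl
          · exact absurd hi hp1
          · exact Or.inr rfl
          · exact absurd ((hR2 _).symm.trans hi) hp1
        · rintro (rfl | rfl)
          · exact hp
          · rw [hR2, hp]
      refine Or.inr (Or.inr (Or.inl ⟨rfl, ?_,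
        colorGroup.nonempty_mulEquiv_shiftProduct_two hR hT'⟩))
      have : {i | c i = u} = {p, p + 2} := by
        ext i
        exact hT' i
      rw [this, ncard_pair ((by decide : ∀ p : ZMod 4, p ≠ p + 2) p)]
    · push Not at hT
      refine Or.inr (Or.inl ⟨rfl, ?_, colorGroup.nonempty_mulEquiv_zmod_two hR hT⟩)
      rw [eq_empty_of_forall_notMem (s := {i | c i = u}) hT, ncard_empty]
  · have hR : ∀ ρ, (∀ i, c (i + ρ) = c i) → ρ = 0 := fun ρ h => by
      rcases cases4 ρ with rfl | rfl | rfl | rfl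
      · rfl
      · exact absurd h hR1
      · exact absurd h hR2
      · exact absurd h hR3
    refine Or.inl ⟨?_, ?_, colorGroup.nonempty_mulEquiv_freeAb hR⟩
    · rw [ncard_eq_one]
      refine ⟨0, Subset.antisymm (fun ρ h => hR ρ h) ?_⟩
      rintro _ rfl
      exact fun i => by simp
    · refine lt_of_lt_of_eq (b := (univ : Set (ZMod 4)).ncard) ?_ huniv
      refine ncard_lt_ncard (ssubset_univ_iff.2 fun h => hR1 fun i => ?_)
      have hall : ∀ i, c i = u := fun i => by
        have : i ∈ {i | c i = u} := h ▸ mem_univ i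
        exact this
      rw [hall, hall]

end ColorGroup

/-! ### Counting arcs and rotations, and the final classification -/

theorem ncard_zmod_four_eq (P : ZMod 4 → Prop) :
    {ρ | P ρ}.ncard = {r : ℤ | 0 ≤ r ∧ r < (4 : ℕ) ∧ P r}.ncard := by
  symm
  refine ncard_congr (fun r _ => (r : ZMod 4)) (fun r hr => hr.2.2) ?_ fun ρ hρ => ?_
  · rintro r s ⟨h1, h2, -⟩ ⟨h3, h4, -⟩ h
    obtain ⟨m, hm⟩ := ZMod.exists_eq_add_mul_four h
    push_cast at h2 h4
    omega
  · refine ⟨ρ.val, ⟨by positivity, by exact_mod_cast ZMod.val_lt ρ, ?_⟩, by simp⟩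
    have : ((ρ.val : ℤ) : ZMod 4) = ρ := by simp
    rw [this]
    exact hρ

theorem ArcSystem.numType2_eq {B : ℂ → ℂ} {θ : ℤ → ℝ} (A : ArcSystem B θ)
    (h : IsCyclicListing B 4 θ) : numType2 B 4 θ = {i | A.color i = univ}.ncard := by
  rw [ncard_zmod_four_eq fun i => A.color i = univ]
  simp only [A.color_intCast h, ← A.isType2_iff]
  rfl

theorem ArcSystem.numRotations_eq {B : ℂ → ℂ} {θ : ℤ → ℝ} (A : ArcSystem B θ)
    (h : IsCyclicListing B 4 θ) :
    numRotations B 4 θ = {ρ | ∀ i, A.color (i + ρ) = A.color i}.ncard := by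
  rw [ncard_zmod_four_eq fun ρ => ∀ i, A.color (i + ρ) = A.color i]
  simp only [(ZMod.intCast_surjective (n := 4)).forall, ← Int.cast_add, A.color_intCast h,
    ← A.sameArcType_iff]
  rfl

theorem exists_isCyclicListing {B : ℂ → ℂ} (h4 : (singularSet B).encard = 4) :
    ∃ θ, IsCyclicListing B 4 θ := by
  classical
  have hpi := Real.two_pi_pos
  have hfin : (singularSet B).Finite := finite_of_encard_eq_coe (k := 4) h4
  have hcard : hfin.toFinset.card = 4 := by
    rw [hfin.encard_eq_coe_toFinset_card] at h4
    exact_mod_cast h4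
  set a : Circle → ℝ := fun ξ => toIcoMod hpi 0 (ξ : ℂ).arg with ha
  have hexp : ∀ ξ, Circle.exp (a ξ) = ξ := fun ξ => by
    conv_rhs => rw [← Circle.exp_arg ξ]
    rw [Circle.exp_eq_exp]
    refine ⟨-toIcoDiv hpi 0 (ξ : ℂ).arg, ?_⟩
    simp only [ha, toIcoMod, zsmul_eq_mul]
    push_cast
    ring
  have hmem : ∀ ξ, a ξ ∈ Ico 0 (2 * Real.pi) := fun ξ => by
    simpa using toIcoMod_mem_Ico hpi 0 (ξ : ℂ).arg
  have hainj : Function.Injective a := fun ξ η h => by rw [← hexp ξ, h, hexp]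
  set F : Finset ℝ := hfin.toFinset.image a
  have hF : F.card = 4 := by rw [Finset.card_image_of_injective _ hainj, hcard]
  have hFm : ∀ t, t ∈ F ↔ ∃ ξ ∈ singularSet B, a ξ = t := fun t => by simp [F]
  set s := F.orderEmbOfFin hF
  have hs : ∀ i, s i ∈ F := fun i => Finset.orderEmbOfFin_mem _ _ _
  have hs' : ∀ i, s i ∈ Ico 0 (2 * Real.pi) := fun i => by
    obtain ⟨ξ, -, h⟩ := (hFm _).1 (hs i)
    exact h ▸ hmem ξ
  have hlt : ∀ j : ℤ, (j % 4).toNat < 4 := fun j => by omega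
  -- The four arguments in `[0, 2π)`, sorted, are repeated with one full turn added after every
  -- four. At the wrap `j % 4 = 3` the sequence still increases because all the arguments lie in an
  -- interval of length `2π`.
  set θ : ℤ → ℝ := fun j => s ⟨(j % 4).toNat, hlt j⟩ + (j / 4 : ℤ) * (2 * Real.pi) with hθ
  have hexpθ : ∀ j, Circle.exp (θ j) = Circle.exp (s ⟨(j % 4).toNat, hlt j⟩) := fun j =>
    Circle.exp_eq_exp.2 ⟨_, rfl⟩
  refine ⟨θ, strictMono_int_of_lt_succ fun j => ?_, fun j => ?_, ?_⟩
  · simp only [hθ]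
    by_cases hj : j % 4 = 3
    · have e : (j + 1) / 4 = j / 4 + 1 := by omega
      rw [e]
      push_cast
      linarith [(hs' ⟨(j % 4).toNat, hlt j⟩).2, (hs' ⟨((j + 1) % 4).toNat, hlt (j + 1)⟩).1]
    · have e : (j + 1) / 4 = j / 4 := by omega
      rw [e]
      refine add_lt_add_left (s.strictMono ?_) _
      rw [Fin.lt_def]
      simp only
      omega
  · have e : (j + (4 : ℕ)) / 4 = j / 4 + 1 := by omega
    have e' : (j + (4 : ℕ)) % 4 = j % 4 := by omega
    simp only [hθ, e, e']
    push_cast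
    ring
  · ext ξ
    constructor
    · intro hξ
      have h1 : a ξ ∈ range s := by
        rw [Finset.range_orderEmbOfFin]
        exact (hFm _).2 ⟨ξ, hξ, rfl⟩
      obtain ⟨i, hi⟩ := h1
      refine ⟨(i : ℕ), ?_⟩
      have e : (⟨(((i : ℕ) : ℤ) % 4).toNat, hlt _⟩ : Fin 4) = i := by
        ext
        have := i.2
        simp only
        omega
      simp only [hexpθ, e, hi, hexp]
    · rintro ⟨j, rfl⟩
      obtain ⟨ξ, hξ, h1⟩ := (hFm _).1 (hs ⟨(j % 4).toNat, hlt j⟩)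
      simp only [hexpθ, ← h1, hexp]
      exact hξ

theorem nonempty_mulEquiv_of_nonempty {G H K : Type*} [Mul G] [Mul H] [Mul K]
    (h₁ : Nonempty (G ≃* H)) (h₂ : Nonempty (H ≃* K)) : Nonempty (G ≃* K) :=
  ⟨h₁.some.trans h₂.some⟩

theorem classification_of_isCyclicListing {B : ℂ → ℂ} (hB : IsBlaschkeProduct B)
    {θ : ℤ → ℝ} (h : IsCyclicListing B 4 θ) :
      (numRotations B 4 θ = 1 ∧ numType2 B 4 θ = 0 ∧ Nonempty (invariants B ≃* Unit)) ∨
      (numRotations B 4 θ = 1 ∧ numType2 B 4 θ = 1 ∧ Nonempty (invariants B ≃* FreeAb 1)) ∨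
      (numRotations B 4 θ = 1 ∧ numType2 B 4 θ = 2 ∧ Nonempty (invariants B ≃* FreeAb 2)) ∨
      (numRotations B 4 θ = 1 ∧ numType2 B 4 θ = 3 ∧ Nonempty (invariants B ≃* FreeAb 3)) ∨
      (numRotations B 4 θ = 2 ∧ numType2 B 4 θ = 0 ∧
        Nonempty (invariants B ≃* Multiplicative (ZMod 2))) ∨
      (numRotations B 4 θ = 2 ∧ numType2 B 4 θ = 2 ∧
        Nonempty (invariants B ≃* ShiftProduct 2)) ∨
      (numRotations B 4 θ = 4 ∧ numType2 B 4 θ = 0 ∧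
        Nonempty (invariants B ≃* Multiplicative (ZMod 4))) ∨
      (numRotations B 4 θ = 4 ∧ numType2 B 4 θ = 4 ∧
        Nonempty (invariants B ≃* ShiftProduct 4)) := by
  obtain ⟨A⟩ := ArcSystem.nonempty hB h
  have e := A.nonempty_mulEquiv h
  have hcl := colorGroup.classification A.color univ
  rw [← A.numType2_eq h, ← A.numRotations_eq h] at hcl
  have tr : ∀ {K : Type} [Mul K], Nonempty (colorGroup A.color univ ≃* K) →
      Nonempty (invariants B ≃* K) := fun h' => nonempty_mulEquiv_of_nonempty e h'
  rcases hcl with ⟨h1, h2, h3⟩ | ⟨h1, h2, h3⟩ | ⟨h1, h2, h3⟩ | ⟨h1, h2, h3⟩ | ⟨h1, h2, h3⟩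
  · generalize numType2 B 4 θ = k at *
    interval_cases k
    · have hU : Nonempty (FreeAb 0 ≃* Unit) := ⟨MulEquiv.ofUnique⟩
      exact Or.inl ⟨h1, rfl, nonempty_mulEquiv_of_nonempty (tr h3) hU⟩
    · exact Or.inr (Or.inl ⟨h1, rfl, tr h3⟩)
    · exact Or.inr (Or.inr (Or.inl ⟨h1, rfl, tr h3⟩))
    · exact Or.inr (Or.inr (Or.inr (Or.inl ⟨h1, rfl, tr h3⟩)))
  · exact Or.inr (Or.inr (Or.inr (Or.inr (Or.inl ⟨h1, h2, tr h3⟩))))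
  · exact Or.inr (Or.inr (Or.inr (Or.inr (Or.inr (Or.inl ⟨h1, h2, tr h3⟩)))))
  · exact Or.inr (Or.inr (Or.inr (Or.inr (Or.inr (Or.inr (Or.inl ⟨h1, h2, tr h3⟩))))))
  · exact Or.inr (Or.inr (Or.inr (Or.inr (Or.inr (Or.inr (Or.inr ⟨h1, h2, tr h3⟩))))))

theorem mainTheorem4 (B : ℂ → ℂ) (hB : IsBlaschkeProduct B)
    (h4 : (singularSet B).encard = 4) :
    -- the list of possible groups
    (Nonempty (invariants B ≃* Unit) ∨
      Nonempty (invariants B ≃* Multiplicative (ZMod 2)) ∨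
      Nonempty (invariants B ≃* Multiplicative (ZMod 4)) ∨
      Nonempty (invariants B ≃* FreeAb 1) ∨
      Nonempty (invariants B ≃* FreeAb 2) ∨
      Nonempty (invariants B ≃* FreeAb 3) ∨
      Nonempty (invariants B ≃* ShiftProduct 2) ∨
      Nonempty (invariants B ≃* ShiftProduct 4)) ∧
    -- which of them occurs, in terms of the types of the four arcs
    ∀ θ : ℤ → ℝ, IsCyclicListing B 4 θ →
      (numRotations B 4 θ = 1 ∧ numType2 B 4 θ = 0 ∧ Nonempty (invariants B ≃* Unit)) ∨
      (numRotations B 4 θ = 1 ∧ numType2 B 4 θ = 1 ∧ Nonempty (invariants B ≃* FreeAb 1)) ∨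
      (numRotations B 4 θ = 1 ∧ numType2 B 4 θ = 2 ∧ Nonempty (invariants B ≃* FreeAb 2)) ∨
      (numRotations B 4 θ = 1 ∧ numType2 B 4 θ = 3 ∧ Nonempty (invariants B ≃* FreeAb 3)) ∨
      (numRotations B 4 θ = 2 ∧ numType2 B 4 θ = 0 ∧
        Nonempty (invariants B ≃* Multiplicative (ZMod 2))) ∨
      (numRotations B 4 θ = 2 ∧ numType2 B 4 θ = 2 ∧
        Nonempty (invariants B ≃* ShiftProduct 2)) ∨
      (numRotations B 4 θ = 4 ∧ numType2 B 4 θ = 0 ∧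
        Nonempty (invariants B ≃* Multiplicative (ZMod 4))) ∨
      (numRotations B 4 θ = 4 ∧ numType2 B 4 θ = 4 ∧
        Nonempty (invariants B ≃* ShiftProduct 4)) := by

  have hmain := fun θ (h : IsCyclicListing B 4 θ) => classification_of_isCyclicListing hB h
  refine ⟨?_, hmain⟩
  obtain ⟨θ, h⟩ := exists_isCyclicListing h4
  rcases hmain θ h with ⟨-, -, e⟩ | ⟨-, -, e⟩ | ⟨-, -, e⟩ | ⟨-, -, e⟩ | ⟨-, -, e⟩ | ⟨-, -, e⟩ |
    ⟨-, -, e⟩ | ⟨-, -, e⟩ <;> tauto
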